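/- Let $d\in\{2,3\}$ and let $\Omega=[0,2\pi]^d$ with periodic boundary conditions. For $u\in L^2(\Omega;\mathbb C^d)$ write $\hat u(k)=(2\pi)^{-d}\int_\Omega u(x)e^{-ik\cdot x}\,dx$ ($k\in\mathbb Z^d$), and let $$H_{\mathbb C}=\{u\in L^2(\Omega;\mathbb C^d):\ \hat u(0)=0,\ k\cdot\hat u(k)=0\ \text{for all }k\}$$ be the space of mean-free, divergence-free fields. For $r>\frac{d+1}2$ and $\beta>0$ define the Gevrey norms $$\|u\|_\beta^2=(2\pi)^d\sum_{k\ne0}|k|^{2r}e^{2\beta|k|}|\hat u(k)|^2,\qquad \|(v,w)\|_\beta^2=\|v\|_\beta^2+\|w\|_\beta^2,$$ and put $C_W(r)=\dfrac{1}{\pi 2^{d-1}}\,\dfrac{2r-d}{2r-1-d}$. The complexified inviscid MHD equations in Elsässer variables are $$\frac{dv}{d\zeta}+(w\cdot\nabla)v+\nabla\mathcal P=0,\quad \frac{dw}{d\zeta}+(v\cdot\nabla)w+\nabla\mathcal P=0,\quad \nabla\cdot v=\nabla\cdot w=0,\quad v(0)=v_0,\ w(0)=w_0,$$ where $\zeta\in\mathbb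 C$ is complex time. A solution on a punctured disc $\mathcal R=\{0<|\zeta|<\rho\}$, $0<\rho\le\infty$, is a holomorphic map $(v,w):\mathcal R\to H_{\mathbb C}\times H_{\mathbb C}$ (with respect to the $L^2$ norm) such that for every $\zeta\in\mathcal R$ the fields $v(\zeta),w(\zeta)$ have first weak derivatives in $L^2(\Omega)$, both evolution equations hold almost everywhere in $\Omega$ with one common periodic scalar pressure $\mathcal P(\zeta)$ (integrable, with integrable first weak derivatives), and $(v(\zeta),w(\zeta))\to(v_0,w_0)$ in $L^2$ as $\zeta\to0$. **Theorem.** There is a constant $C>0$ depending only on $d$ such that the following holds. Let $r>\frac{d+1}2$, $\beta_0>0$, and let $v_0,w_0\in H_{\mathbb C}$ (for instance real-valued) satisfy $\|(v_0,w_0)\|_{\beta_0}<\infty$. Then the complexified inviscid MHD equations have a unique solution $(v(\zeta),w(\zeta))$ in the region $$\mathcal R=\Big\{\zeta\in\mathbb C:\ 0<|\zeta|<\frac{C\beta_0}{2^r\,C_W(r)\,\|(v_0,w_0)\|_{\beta_0}}\Big\}$$ (the whole punctured plane if $v_0=w_0=0$). Moreover, this solution is holomorphic with values in the Gevrey class: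 for each $\zeta\in\mathcal R$ there is a $\beta>0$ such that, near $\zeta$, the fields $v$ and $w$ have finite norm $\|\cdot\|_\beta$, and both are complex differentiable at $\zeta$ with respect to $\|\cdot\|_\beta$. -/

import Mathlib

open MeasureTheory Filter Topology

noncomputable section

namespace MHD

instance factTwoPiPos : Fact (0 < 2 * Real.pi) := ⟨Real.two_pi_pos⟩

/-- The periodic box `Ω = [0, 2π]^d`, with opposite faces identified.  Its measure `volume` is the
Lebesgue measure, of total mass `(2π)^d`. -/
abbrev Torus (d : ℕ) : Type := Fin d → AddCircle (2 * Real.pi)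

/-- Complex vectors with `d` components and the Hermitian length. -/
abbrev Vec (d : ℕ) : Type := EuclideanSpace ℂ (Fin d)

/-- The complexification of `(L²(Ω))^d`, with its norm `‖u‖² = ∫_Ω |u(x)|² dx`. -/
abbrev L2 (d : ℕ) : Type := Lp (Vec d) 2 (volume : Measure (Torus d))

/-- The character `x ↦ e^{i k·x}`. -/
def character {d : ℕ} (k : Fin d → ℤ) (x : Torus d) : ℂ := ∏ j, fourier (k j) (x j)

/-- Fourier coefficients: `û(k) = (2π)^{-d} ∫_Ω u(x) e^{-i k·x} dx`. -/
def fourierCoefficient {d : ℕ} {F : Type*} [NormedAddCommGroup F] [NormedSpace ℂ F]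
    (u : Torus d → F) (k : Fin d → ℤ) : F :=
  (((2 * Real.pi : ℝ) : ℂ) ^ d)⁻¹ • ∫ x, character (-k) x • u x

/-- The Euclidean length `|k|` of a wave vector. -/
def freqNorm {d : ℕ} (k : Fin d → ℤ) : ℝ := Real.sqrt (∑ j, (k j : ℝ) ^ 2)

/-- Membership in the complexified phase space `H_ℂ`: mean zero, and divergence free in the sense
of distributions, that is `û(0) = 0` and `k · û(k) = 0` for all `k`. -/
def MemH {d : ℕ} (u : L2 d) : Prop :=
  fourierCoefficient u 0 = 0 ∧
    ∀ k : Fin d → ℤ, ∑ j, (k j : ℂ) * fourierCoefficient u k j = 0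

/-- `g = ∂_j f` on the torus in the sense of distributions, `f` and `g` being integrable.  The test
functions are the characters, whose span is dense in the smooth periodic functions. -/
def HasWeakPartial {d : ℕ} {F : Type*} [NormedAddCommGroup F] [NormedSpace ℂ F]
    (j : Fin d) (f g : Torus d → F) : Prop :=
  Integrable f ∧ Integrable g ∧
    ∀ k : Fin d → ℤ,
      fourierCoefficient g k = (Complex.I * (k j : ℂ)) • fourierCoefficient f k

/-- The `k`-th term of
`‖A^{r/2} e^{β A^{1/2}} u‖² = (2π)^d ∑_k |k|^{2r} e^{2β|k|} |û(k)|²`. -/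
def gevreyTerm {d : ℕ} (r β : ℝ) (u : L2 d) (k : Fin d → ℤ) : ℝ :=
  (2 * Real.pi) ^ d * (freqNorm k ^ (2 * r) * Real.exp (2 * β * freqNorm k) *
    ‖fourierCoefficient u k‖ ^ 2)

/-- `‖u‖_β < ∞`. -/
def GevreyFinite {d : ℕ} (r β : ℝ) (u : L2 d) : Prop := Summable (gevreyTerm r β u)

/-- The Gevrey norm `‖u‖_β = ‖A^{r/2} e^{β A^{1/2}} u‖` (meaningful when `GevreyFinite r β u`). -/
def gevreyNorm {d : ℕ} (r β : ℝ) (u : L2 d) : ℝ := Real.sqrt (∑' k, gevreyTerm r β u k)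

/-- The Gevrey norm of a pair, `‖(v, w)‖_β² = ‖v‖_β² + ‖w‖_β²`. -/
def gevreyPairNorm {d : ℕ} (r β : ℝ) (v w : L2 d) : ℝ :=
  Real.sqrt (gevreyNorm r β v ^ 2 + gevreyNorm r β w ^ 2)

/-- The constant `C_W(r) = (1 / (π 2^{d-1})) (2r - d) / (2r - 1 - d)`. -/
def wienerConst (d : ℕ) (r : ℝ) : ℝ :=
  1 / (Real.pi * 2 ^ ((d : ℝ) - 1)) * ((2 * r - d) / (2 * r - 1 - d))

/-- The punctured disc `0 < |ζ| < C β₀ / (2^r C_W(r) N)`, written without the division so that it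
is the whole punctured plane if `N = 0`. -/
def region (d : ℕ) (C r β₀ N : ℝ) : Set ℂ :=
  {ζ : ℂ | 0 < ‖ζ‖ ∧ ‖ζ‖ * ((2 : ℝ) ^ r * wienerConst d r * N) < C * β₀}

/-- `z ↦ u z` is complex differentiable at `ζ` with respect to a Gevrey norm `‖·‖_β`, for some
`β > 0` (near `ζ` its values have finite norm `‖·‖_β`). -/
def GevreyDifferentiableAt {d : ℕ} (r : ℝ) (u : ℂ → L2 d) (ζ : ℂ) : Prop :=
  ∃ β : ℝ, 0 < β ∧ (∀ᶠ z in 𝓝 ζ, GevreyFinite r β (u z)) ∧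
    ∃ u' : L2 d, GevreyFinite r β u' ∧
      Tendsto (fun z => gevreyNorm r β ((z - ζ)⁻¹ • (u z - u ζ) - u')) (𝓝[≠] ζ) (𝓝 0)

/-- The complexified equation `v' + (w · ∇) v + ∇p = 0` at one complex time, where `v'` is the time
derivative: `v` has weak first derivatives `∂_j v ∈ L²`, the scalar `p` has weak first
derivatives, and the equation holds almost everywhere in `Ω`. -/
def TransportEq {d : ℕ} (v' w v : L2 d) (p : Torus d → ℂ) : Prop :=
  ∃ (Dv : Fin d → L2 d) (Dp : Fin d → Torus d → ℂ),
    (∀ j, HasWeakPartial j v (Dv j)) ∧ (∀ j, HasWeakPartial j p (Dp j)) ∧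
      ∀ᵐ x, ∀ i, v' x i + ∑ j, w x j * Dv j x i + Dp i x = 0

/-- `(v, w)` solves the complexified inviscid MHD equations in Elsässer variables on a set `R` of
complex times with `0` in its closure, with initial data `(v₀, w₀)`: it is a holomorphic function
on `R` with values in `H_ℂ × H_ℂ`, it satisfies the two evolution equations with a common
pressure `p`, and it tends to `(v₀, w₀)` in `L²` as `ζ → 0` in `R`. -/
structure IsSolution {d : ℕ} (R : Set ℂ) (v₀ w₀ : L2 d) (v w : ℂ → L2 d) : Prop where
  mem_left : ∀ ζ ∈ R, MemH (v ζ)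
  mem_right : ∀ ζ ∈ R, MemH (w ζ)
  equation : ∀ ζ ∈ R, ∃ (v' w' : L2 d) (p : Torus d → ℂ),
    HasDerivAt v v' ζ ∧ HasDerivAt w w' ζ ∧
      TransportEq v' (w ζ) (v ζ) p ∧ TransportEq w' (v ζ) (w ζ) p
  initial_left : Tendsto v (𝓝[R] 0) (𝓝 v₀)
  initial_right : Tendsto w (𝓝[R] 0) (𝓝 w₀)

end MHD

end

/-! On the Fourier side the equations become `v̂(k)' = -N_k(w, v)`, `ŵ(k)' = -N_k(v, w)`, where
`N_k` (`nonlinearity`) is the `k`-th coefficient of the Leray projection of `div (v ⊗ w)`. The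
pressure disappears and is recovered as `-∑ k_a k_b (w_b v_a)^(k) / |k|²`, which is symmetric in `v`
and `w`, hence common to both equations.

Existence is a Cauchy–Kovalevskaya argument. In the Wiener norm `∑ e^{β|k|} |û(k)|` convolution is
submultiplicative, and the single derivative in `N_k` costs a factor `B / ε` when `β` drops by `ε`
(`wiener_sequenceNonlinearity_le`). The Taylor coefficients in time satisfy a quadratic recursion.
Giving up the share `1 / (n + 2)` of the available weight at step `n + 1` costs a factor of order
`n`, which the factor `1 / (n + 1)` from integrating in time repays, so Catalan numbers majorise the
recursion (`wiener_taylor_le`). At weight `β₀ / 2` the growth is geometric, with radius of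
convergence at least `β₀ / (32 B N)`, where `N` bounds the Wiener norm of the data. Cauchy–Schwarz
bounds this norm by a constant depending on `d` times the Gevrey norm, because `2r > d + 1`
(`wiener_le_gevreyNorm`). Since `2^r C_W(r)` is bounded below by a positive constant depending only
on `d`, the stated disc lies inside the disc of convergence for small `C`. The series is summed in a
weighted `ℓ¹` space, which maps boundedly to `L²` and to a Gevrey space of smaller weight, so a
single termwise differentiation gives both kinds of differentiability (`exists_isSolution`).

Uniqueness needs no energy estimate (`IsSolution.eqOn`). The difference of two solutions extends
holomorphically to `0` with value `0`; if not identically zero near `0`, it is `z^n g(z)` with `n ≥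
1` and `g(0) ≠ 0`. At a fixed frequency `N_k` is continuous on `L² × L²`, so comparing terms of
order `z^{n-1}` in the equation gives `n ĝ(0)(k) = 0` for every `k`, a contradiction. The identity
theorem then covers the whole disc. -/

noncomputable section

namespace MHD

open scoped ComplexConjugate ENNReal

/-! ### Characters of the torus and their density -/

section Characters

variable {d : ℕ}

/-- The character `x ↦ e^{i k·x}` as a continuous function. -/
def characterMap (k : Fin d → ℤ) : C(Torus d, ℂ) where
  toFun := character k
  continuous_toFun := by unfold character; fun_prop

@[simp] lemma characterMap_apply (k : Fin d → ℤ) (x : Torus d) :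
    characterMap k x = character k x := rfl

lemma continuous_character (k : Fin d → ℤ) : Continuous (character k) :=
  (characterMap k).continuous

lemma character_neg (k : Fin d → ℤ) (x : Torus d) : character (-k) x = conj (character k x) := by
  simp only [character, Pi.neg_apply, fourier_neg, map_prod]

lemma character_add (k m : Fin d → ℤ) (x : Torus d) :
    character (k + m) x = character k x * character m x := by
  simp only [character, Pi.add_apply, fourier_add, ← Finset.prod_mul_distrib]

@[simp] lemma character_zero (x : Torus d) : character (0 : Fin d → ℤ) x = 1 := by
  simp [character]

@[simp] lemma norm_character (k : Fin d → ℤ) (x : Torus d) : ‖character k x‖ = 1 := by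
  simp only [character, fourier_apply, norm_prod, Circle.norm_coe, Finset.prod_const_one]

lemma character_single (j : Fin d) (x : Torus d) :
    character (Pi.single j 1) x = fourier 1 (x j) := by
  unfold character
  rw [Finset.prod_eq_single j]
  · simp
  · intro b _ hb; simp [hb]
  · simp

/-- The star subalgebra of continuous functions generated by the characters. -/
def characterSubalgebra (d : ℕ) : StarSubalgebra ℂ C(Torus d, ℂ) where
  toSubalgebra := Algebra.adjoin ℂ (Set.range characterMap)
  star_mem' := by
    change Algebra.adjoin ℂ (Set.range characterMap) ≤
      star (Algebra.adjoin ℂ (Set.range characterMap))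
    refine Algebra.adjoin_le ?_
    rintro _ ⟨n, rfl⟩
    refine Algebra.subset_adjoin ⟨-n, ?_⟩
    ext1 x
    simp only [characterMap_apply, character_neg, starRingEnd_apply, ContinuousMap.star_apply]

lemma characterSubalgebra_coe :
    (characterSubalgebra d).toSubalgebra.toSubmodule
      = Submodule.span ℂ (Set.range characterMap) := by
  apply Algebra.adjoin_eq_span_of_subset
  refine .trans (fun x ↦ Submonoid.closure_induction (fun _ ↦ id) ⟨0, ?_⟩ ?_)
    Submodule.subset_span
  · ext z; simp
  · rintro _ _ _ _ ⟨m, rfl⟩ ⟨n, rfl⟩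
    refine ⟨m + n, ?_⟩
    ext z
    simp [character_add]

/-- If two points differ in coordinate `i`, the character of the unit frequency in direction `i`
distinguishes them, since `y ↦ e^{iy}` is injective on the circle. -/
lemma characterSubalgebra_separatesPoints :
    (characterSubalgebra d).toSubalgebra.SeparatesPoints := by
  intro x y hxy
  rw [Ne, funext_iff, not_forall] at hxy
  obtain ⟨i, hi⟩ := hxy
  refine ⟨_, ⟨characterMap (Pi.single i 1), Algebra.subset_adjoin ⟨Pi.single i 1, rfl⟩, rfl⟩, ?_⟩
  change character _ x ≠ character _ y
  rw [character_single, character_single, fourier_one, fourier_one, Ne]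
  contrapose hi
  replace hi := Circle.ext hi
  exact AddCircle.injective_toCircle Real.two_pi_pos.ne' hi

/-- Stone–Weierstrass: the characters are closed under products and conjugation, so their span is
the star subalgebra they generate. -/
lemma span_characterMap_closure_eq_top :
    (Submodule.span ℂ (Set.range (characterMap (d := d)))).topologicalClosure = ⊤ := by
  rw [← characterSubalgebra_coe]
  exact congr_arg (Subalgebra.toSubmodule <| StarSubalgebra.toSubalgebra ·)
    (ContinuousMap.starSubalgebra_topologicalClosure_eq_top_of_separatesPoints _
      characterSubalgebra_separatesPoints)

lemma integral_character (k : Fin d → ℤ) :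
    ∫ x, character k x = if k = 0 then ((2 * Real.pi : ℝ) : ℂ) ^ d else 0 := by
  unfold character
  rw [MeasureTheory.integral_fintype_prod_volume_eq_prod (fun j (y : AddCircle (2 * Real.pi)) =>
    fourier (k j) y)]
  have key : ∀ n : ℤ, ∫ y : AddCircle (2 * Real.pi), (fourier n y : ℂ)
      = if n = 0 then ((2 * Real.pi : ℝ) : ℂ) else 0 := by
    intro n
    -- Orthonormality holds for the probability Haar measure; the factor `2π` below converts to
    -- Lebesgue measure.
    have h1 := orthonormal_iff_ite.mp (orthonormal_fourier (T := 2 * Real.pi)) 0 n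
    simp only [ContinuousMap.inner_toLp, ← fourier_neg, ← fourier_add] at h1
    rw [AddCircle.integral_haarAddCircle] at h1
    simp only [neg_zero, add_zero, eq_comm (a := (0 : ℤ))] at h1
    have h2 : (∫ y : AddCircle (2 * Real.pi), (fourier n y : ℂ)) =
        ((2 * Real.pi : ℝ) : ℂ) * ((2 * Real.pi : ℝ)⁻¹ •
          ∫ y : AddCircle (2 * Real.pi), (fourier n y : ℂ)) := by
      rw [Complex.real_smul, ← mul_assoc, ← Complex.ofReal_mul,
        mul_inv_cancel₀ Real.two_pi_pos.ne', Complex.ofReal_one, one_mul]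
    rw [h2, h1]
    split_ifs <;> simp
  simp_rw [key]
  split_ifs with h
  · subst h; simp
  · obtain ⟨i, hi⟩ := Function.ne_iff.mp h
    exact Finset.prod_eq_zero (Finset.mem_univ i) (by simpa using hi)

/-- The total mass `(2π)^d` of the torus, as a complex number. -/
def vol (d : ℕ) : ℂ := ((2 * Real.pi : ℝ) : ℂ) ^ d

lemma vol_ne_zero (d : ℕ) : vol d ≠ 0 :=
  pow_ne_zero _ (by exact_mod_cast Real.two_pi_pos.ne')

end Characters

/-! ### Fourier series and the convolution theorem in `L²` -/

section Scalar

variable {d : ℕ}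

/-- The scalar space `L²(Ω; ℂ)`. -/
abbrev ScalarL2 (d : ℕ) : Type := Lp ℂ 2 (volume : Measure (Torus d))

/-- The character as an element of `L²`. -/
def characterLp (k : Fin d → ℤ) : ScalarL2 d :=
  ContinuousMap.toLp (E := ℂ) 2 volume ℂ (characterMap k)

lemma coeFn_characterLp (k : Fin d → ℤ) : characterLp k =ᵐ[volume] character k :=
  ContinuousMap.coeFn_toLp volume (characterMap k)

lemma span_characterLp_closure_eq_top :
    (Submodule.span ℂ (Set.range (characterLp (d := d)))).topologicalClosure = ⊤ := by
  simpa only [Submodule.map_span, ContinuousLinearMap.coe_coe, ← Set.range_comp,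
    Function.comp_def] using!
    (ContinuousMap.toLp_denseRange ℂ (volume : Measure (Torus d)) ℂ
      (p := 2) (by simp)).topologicalClosure_map_submodule span_characterMap_closure_eq_top

lemma inner_characterLp_left (k : Fin d → ℤ) (f : ScalarL2 d) :
    inner ℂ (characterLp k) f = vol d * fourierCoefficient f k := by
  unfold fourierCoefficient
  rw [smul_eq_mul, ← vol, mul_inv_cancel_left₀ (vol_ne_zero d), MeasureTheory.L2.inner_def]
  apply integral_congr_ae
  filter_upwards [coeFn_characterLp k] with x hx
  rw [hx, character_neg, RCLike.inner_apply, mul_comm, smul_eq_mul]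

lemma fourierCoefficient_congr {F : Type*} [NormedAddCommGroup F] [NormedSpace ℂ F]
    {f g : Torus d → F} (h : f =ᵐ[volume] g) (k : Fin d → ℤ) :
    fourierCoefficient f k = fourierCoefficient g k := by
  unfold fourierCoefficient
  congr 1
  apply integral_congr_ae
  filter_upwards [h] with x hx
  rw [hx]

lemma fourierCoefficient_character (k m : Fin d → ℤ) :
    fourierCoefficient (character m) k = if m = k then 1 else 0 := by
  unfold fourierCoefficient
  simp_rw [smul_eq_mul, ← character_add, integral_character]
  rw [← vol]
  have : -k + m = 0 ↔ m = k := by rw [neg_add_eq_zero, eq_comm]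
  simp only [this]
  split_ifs
  · exact inv_mul_cancel₀ (vol_ne_zero d)
  · simp

lemma inner_characterLp (k m : Fin d → ℤ) :
    inner ℂ (characterLp k) (characterLp m) = if m = k then vol d else 0 := by
  rw [inner_characterLp_left, fourierCoefficient_congr (coeFn_characterLp m),
    fourierCoefficient_character]
  split_ifs <;> simp

/-- The normalising factor `(2π)^{-d/2}`. -/
def normFactor (d : ℕ) : ℂ := ((Real.sqrt ((2 * Real.pi) ^ d))⁻¹ : ℝ)

lemma normFactor_sq (d : ℕ) : normFactor d * normFactor d = (vol d)⁻¹ := by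
  unfold normFactor vol
  rw [← Complex.ofReal_mul, ← mul_inv, Real.mul_self_sqrt (by positivity)]
  push_cast; rfl

lemma conj_normFactor (d : ℕ) : conj (normFactor d) = normFactor d := Complex.conj_ofReal _

lemma normFactor_ne_zero (d : ℕ) : normFactor d ≠ 0 := fun h =>
  inv_ne_zero (vol_ne_zero d) (by rw [← normFactor_sq, h, mul_zero])

lemma orthonormal_characterLp :
    Orthonormal ℂ (fun k : Fin d → ℤ => normFactor d • characterLp k) := by
  classical
  rw [orthonormal_iff_ite]
  intro k m
  rw [inner_smul_left, inner_smul_right, conj_normFactor, ← mul_assoc, normFactor_sq,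
    inner_characterLp]
  simp only [eq_comm (a := m)]
  split_ifs
  · exact inv_mul_cancel₀ (vol_ne_zero d)
  · simp

/-- The Hilbert basis of normalised characters. -/
def characterBasis (d : ℕ) : HilbertBasis (Fin d → ℤ) ℂ (ScalarL2 d) :=
  HilbertBasis.mk orthonormal_characterLp (by
    rw [← span_characterLp_closure_eq_top]
    apply Submodule.topologicalClosure_mono
    rw [Submodule.span_le]
    rintro _ ⟨k, rfl⟩
    have : characterLp k = (normFactor d)⁻¹ • (normFactor d • characterLp k) := by
      rw [smul_smul, inv_mul_cancel₀ (normFactor_ne_zero d), one_smul]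
    rw [SetLike.mem_coe, this]
    exact Submodule.smul_mem _ _ (Submodule.subset_span ⟨k, rfl⟩))

/-- The Fourier series of an `L²` function converges to it in `L²`. -/
lemma hasSum_fourierCoefficient_smul (f : ScalarL2 d) :
    HasSum (fun k => fourierCoefficient f k • characterLp k) f := by
  have h := (characterBasis d).hasSum_repr f
  refine h.congr_fun fun k => ?_
  rw [HilbertBasis.repr_apply_apply, characterBasis, HilbertBasis.coe_mk, inner_smul_left,
    inner_characterLp_left, smul_smul, conj_normFactor]
  congr 1
  rw [mul_right_comm, normFactor_sq, inv_mul_cancel_left₀ (vol_ne_zero d)]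

lemma eq_zero_of_fourierCoefficient_eq_zero (f : ScalarL2 d)
    (h : ∀ k, fourierCoefficient f k = 0) : f = 0 := by
  have h1 := hasSum_fourierCoefficient_smul f
  simp only [h, zero_smul] at h1
  exact h1.unique hasSum_zero

/-- Convolution theorem for products of square integrable functions. -/
lemma hasSum_fourierCoefficient_mul (f g : ScalarL2 d) (k : Fin d → ℤ) :
    HasSum (fun m => fourierCoefficient f (k - m) * fourierCoefficient g m)
      (fourierCoefficient (fun x => f x * g x) k) := by
  -- With `e^{-ik·x} f` fixed in `L²`, the coefficient of `f g` at `k` is a bounded linear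
  -- functional of `g`, so the Fourier series of `g` may be inserted termwise.
  have hF : MemLp (fun x => character (-k) x * f x) 2 (volume : Measure (Torus d)) := by
    refine (Lp.memLp f).of_le ?_ (Eventually.of_forall fun x => by simp)
    exact (continuous_character _).aestronglyMeasurable.mul (Lp.aestronglyMeasurable f)
  have hs := (hasSum_fourierCoefficient_smul g).mapL
    ((ContinuousLinearMap.mul ℂ ℂ).lpPairing volume 2 2 hF.toLp)
  have hs' := hs.mul_left ((vol d)⁻¹)
  have e : (vol d)⁻¹ * ((ContinuousLinearMap.mul ℂ ℂ).lpPairing volume 2 2 hF.toLp) g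
      = fourierCoefficient (fun x => f x * g x) k := by
    unfold fourierCoefficient
    rw [ContinuousLinearMap.lpPairing_eq_integral, smul_eq_mul, vol]
    congr 1
    apply integral_congr_ae
    filter_upwards [hF.coeFn_toLp] with x hx
    simp [hx, mul_assoc]
  rw [← e]
  refine hs'.congr_fun fun m => ?_
  rw [map_smul, ContinuousLinearMap.lpPairing_eq_integral, smul_eq_mul, mul_left_comm, mul_comm]
  congr 1
  unfold fourierCoefficient
  rw [smul_eq_mul, vol]
  congr 1
  apply integral_congr_ae
  filter_upwards [hF.coeFn_toLp, coeFn_characterLp m] with x hx hm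
  simp only [hx, hm, ContinuousLinearMap.mul_apply', smul_eq_mul]
  rw [neg_sub, sub_eq_add_neg, character_add]
  ring

end Scalar

/-! ### Vector fields and their Fourier coefficients -/

section Vector

variable {d : ℕ}

/-- The `j`-th component of a square integrable vector field. -/
def component (j : Fin d) : L2 d →L[ℂ] ScalarL2 d :=
  ContinuousLinearMap.compLpL 2 volume (EuclideanSpace.proj j : Vec d →L[ℂ] ℂ)

lemma coeFn_component (j : Fin d) (u : L2 d) : component j u =ᵐ[volume] fun x => u x j :=
  ContinuousLinearMap.coeFn_compLpL (EuclideanSpace.proj j : Vec d →L[ℂ] ℂ) u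

lemma integrable_character_smul {F : Type*} [NormedAddCommGroup F] [NormedSpace ℂ F]
    {f : Torus d → F} (hf : Integrable f) (k : Fin d → ℤ) :
    Integrable (fun x => character k x • f x) :=
  hf.bdd_smul (1 : ℝ) (continuous_character k).aestronglyMeasurable
    (Eventually.of_forall fun x => (norm_character k x).le)

lemma integrable_L2 (u : L2 d) : Integrable u :=
  (Lp.memLp u).integrable (by norm_num)

lemma integrable_scalarL2 (u : ScalarL2 d) : Integrable u :=
  (Lp.memLp u).integrable (by norm_num)

lemma fourierCoefficient_clm {F G : Type*} [NormedAddCommGroup F] [NormedSpace ℂ F]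
    [CompleteSpace F] [NormedAddCommGroup G] [NormedSpace ℂ G] [CompleteSpace G]
    (L : F →L[ℂ] G) {f : Torus d → F} (hf : Integrable f) (k : Fin d → ℤ) :
    fourierCoefficient (fun x => L (f x)) k = L (fourierCoefficient f k) := by
  unfold fourierCoefficient
  rw [map_smul, ← L.integral_comp_comm (integrable_character_smul hf (-k))]
  simp only [map_smul]

lemma fourierCoefficient_add {F : Type*} [NormedAddCommGroup F] [NormedSpace ℂ F]
    {f g : Torus d → F} (hf : Integrable f) (hg : Integrable g) (k : Fin d → ℤ) :
    fourierCoefficient (fun x => f x + g x) k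
      = fourierCoefficient f k + fourierCoefficient g k := by
  unfold fourierCoefficient
  simp only [smul_add]
  rw [integral_add (integrable_character_smul hf (-k)) (integrable_character_smul hg (-k)),
    smul_add]

lemma fourierCoefficient_sum {F ι : Type*} [NormedAddCommGroup F] [NormedSpace ℂ F]
    (s : Finset ι) {f : ι → Torus d → F} (hf : ∀ j ∈ s, Integrable (f j)) (k : Fin d → ℤ) :
    fourierCoefficient (fun x => ∑ j ∈ s, f j x) k = ∑ j ∈ s, fourierCoefficient (f j) k := by
  unfold fourierCoefficient
  simp only [Finset.smul_sum]
  rw [integral_finsetSum s fun j hj => integrable_character_smul (hf j hj) (-k),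
    Finset.smul_sum]

lemma fourierCoefficient_apply (u : L2 d) (k : Fin d → ℤ) (j : Fin d) :
    fourierCoefficient u k j = fourierCoefficient (fun x => u x j) k :=
  (fourierCoefficient_clm (EuclideanSpace.proj j : Vec d →L[ℂ] ℂ) (integrable_L2 u) k).symm

lemma fourierCoefficient_component (u : L2 d) (k : Fin d → ℤ) (j : Fin d) :
    fourierCoefficient (component j u) k = fourierCoefficient u k j := by
  rw [fourierCoefficient_apply, fourierCoefficient_congr (coeFn_component j u)]

lemma L2_eq_zero_of_fourierCoefficient_eq_zero (u : L2 d)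
    (h : ∀ k, fourierCoefficient u k = 0) : u = 0 := by
  have h1 : ∀ j, component j u = 0 := fun j =>
    eq_zero_of_fourierCoefficient_eq_zero _ fun k => by
      rw [fourierCoefficient_component, h]; rfl
  rw [Lp.eq_zero_iff_ae_eq_zero]
  have h2 : ∀ᵐ x, ∀ j, u x j = 0 := by
    rw [ae_all_iff]
    intro j
    filter_upwards [coeFn_component j u, (Lp.eq_zero_iff_ae_eq_zero.mp (h1 j))] with x hx hx'
    rw [← hx, hx']; rfl
  filter_upwards [h2] with x hx
  ext j
  exact hx j

/-- The Fourier coefficient at `k` as a bounded linear map. -/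
def coefficientL (k : Fin d → ℤ) : L2 d →L[ℂ] Vec d :=
  (vol d)⁻¹ • (ContinuousLinearMap.lsmul ℂ ℂ).lpPairing volume 2 2 (characterLp (-k))

lemma coefficientL_apply (k : Fin d → ℤ) (u : L2 d) :
    coefficientL k u = fourierCoefficient u k := by
  unfold coefficientL fourierCoefficient
  rw [_root_.smul_apply, ContinuousLinearMap.lpPairing_eq_integral, vol]
  congr 1
  apply integral_congr_ae
  filter_upwards [coeFn_characterLp (-k)] with x hx
  rw [hx, ContinuousLinearMap.lsmul_apply]

/-- `(w, v) ↦ (w_j v_i)^(k)` as a bounded bilinear map. -/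
def productCoefficient (k : Fin d → ℤ) (i j : Fin d) : L2 d →L[ℂ] L2 d →L[ℂ] ℂ :=
  -- The character acts as an element of `L^∞`: Hölder keeps `e^{-ik·x} w_j` in `L²`, and the `L²`
  -- pairing with `v_i` is then bounded.
  (vol d)⁻¹ • ((ContinuousLinearMap.mul ℂ ℂ).lpPairing volume 2 2).bilinearComp
    (((ContinuousLinearMap.mul ℂ ℂ).holderL volume ∞ 2 2
      (ContinuousMap.toLp (E := ℂ) ∞ volume ℂ (characterMap (-k)))).comp (component j))
    (component i)

lemma productCoefficient_apply (k : Fin d → ℤ) (i j : Fin d) (w v : L2 d) :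
    productCoefficient k i j w v = fourierCoefficient (fun x => w x j * v x i) k := by
  unfold productCoefficient fourierCoefficient
  rw [_root_.smul_apply, _root_.smul_apply,
    ContinuousLinearMap.bilinearComp_apply, ContinuousLinearMap.lpPairing_eq_integral, vol]
  congr 1
  apply integral_congr_ae
  filter_upwards [coeFn_component i v, coeFn_component j w,
    ContinuousLinearMap.coeFn_holder (r := 2) (B := ContinuousLinearMap.mul ℂ ℂ)
      (ContinuousMap.toLp (E := ℂ) ∞ volume ℂ (characterMap (-k))) (component j w),
    ContinuousMap.coeFn_toLp (𝕜 := ℂ) (p := ∞) volume (characterMap (-k))] with x h1 h2 h3 h4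
  rw [h1]
  change ((ContinuousLinearMap.mul ℂ ℂ).holder 2 _ (component j w) : ScalarL2 d) x * _ = _
  rw [h3, h4, h2]
  simp [mul_assoc]

lemma hasSum_productCoefficient (k : Fin d → ℤ) (i j : Fin d) (w v : L2 d) :
    HasSum (fun m => fourierCoefficient w (k - m) j * fourierCoefficient v m i)
      (productCoefficient k i j w v) := by
  have h := hasSum_fourierCoefficient_mul (component j w) (component i v) k
  simp only [fourierCoefficient_component] at h
  rw [productCoefficient_apply]
  convert! h using 1
  apply fourierCoefficient_congr
  filter_upwards [coeFn_component i v, coeFn_component j w] with x h1 h2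
  rw [h1, h2]

lemma integrable_mul_component (w v : L2 d) (i j : Fin d) :
    Integrable (fun x => w x j * v x i) := by
  have h := MemLp.integrable_mul (Lp.memLp (component j w)) (Lp.memLp (component i v))
  refine h.congr ?_
  filter_upwards [coeFn_component i v, coeFn_component j w] with x h1 h2
  simp [h1, h2]

end Vector

/-! ### Leray projection, pressure, and the equations on the Fourier side -/

section Symbol

variable {d : ℕ}

/-- The pressure symbol `-(∑ k_a k_b S_{ab}) / |k|²`. -/
def pressureSymbol (k : Fin d → ℤ) (S : Fin d → Fin d → ℂ) : ℂ :=
  -((∑ a, ∑ b, (k a : ℂ) * (k b : ℂ) * S a b) / ∑ j, (k j : ℂ) ^ 2)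

/-- The symbol of the projected divergence: the `k`-th coefficient of the Leray projection of
`div S`, where `S` is the `k`-th coefficient of a matrix field. -/
def eulerSymbol (k : Fin d → ℤ) (S : Fin d → Fin d → ℂ) : Vec d :=
  WithLp.toLp 2 fun i =>
    Complex.I * (∑ j, (k j : ℂ) * S i j) + Complex.I * (k i : ℂ) * pressureSymbol k S

lemma eulerSymbol_apply (k : Fin d → ℤ) (S : Fin d → Fin d → ℂ) (i : Fin d) :
    eulerSymbol k S i =
      Complex.I * (∑ j, (k j : ℂ) * S i j) + Complex.I * (k i : ℂ) * pressureSymbol k S := rfl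

lemma eulerSymbol_zero_left (S : Fin d → Fin d → ℂ) : eulerSymbol 0 S = 0 := by
  ext i; simp [eulerSymbol_apply]

lemma pressureSymbol_add (k : Fin d → ℤ) (S T : Fin d → Fin d → ℂ) :
    pressureSymbol k (S + T) = pressureSymbol k S + pressureSymbol k T := by
  simp only [pressureSymbol, Pi.add_apply, mul_add, Finset.sum_add_distrib, add_div, neg_add]

lemma pressureSymbol_smul (k : Fin d → ℤ) (c : ℂ) (S : Fin d → Fin d → ℂ) :
    pressureSymbol k (c • S) = c * pressureSymbol k S := by
  simp only [pressureSymbol, Pi.smul_apply, smul_eq_mul, mul_left_comm _ c, ← Finset.mul_sum,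
    mul_div_assoc, mul_neg]

/-- `eulerSymbol` as a linear map of the matrix. -/
def eulerSymbolLinear (k : Fin d → ℤ) : (Fin d → Fin d → ℂ) →ₗ[ℂ] Vec d where
  toFun := eulerSymbol k
  map_add' S T := by
    ext i
    simp only [eulerSymbol_apply, PiLp.add_apply, pressureSymbol_add, Pi.add_apply, mul_add,
      Finset.sum_add_distrib]
    ring
  map_smul' c S := by
    ext i
    simp only [eulerSymbol_apply, PiLp.smul_apply, pressureSymbol_smul, Pi.smul_apply,
      smul_eq_mul, mul_left_comm _ c, ← Finset.mul_sum, RingHom.id_apply]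
    ring

lemma sum_freq_sq (k : Fin d → ℤ) : ∑ j, (k j : ℂ) ^ 2 = ((freqNorm k ^ 2 : ℝ) : ℂ) := by
  unfold freqNorm
  rw [Real.sq_sqrt (Finset.sum_nonneg fun j _ => sq_nonneg _)]
  push_cast; rfl

lemma freqNorm_nonneg (k : Fin d → ℤ) : 0 ≤ freqNorm k := Real.sqrt_nonneg _

lemma freqNorm_eq_zero {k : Fin d → ℤ} : freqNorm k = 0 ↔ k = 0 := by
  unfold freqNorm
  rw [Real.sqrt_eq_zero (Finset.sum_nonneg fun j _ => sq_nonneg _),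
    Finset.sum_eq_zero_iff_of_nonneg fun j _ => sq_nonneg _]
  simp [funext_iff]

lemma sum_freq_sq_ne_zero {k : Fin d → ℤ} (hk : k ≠ 0) : ∑ j, (k j : ℂ) ^ 2 ≠ 0 := by
  rw [sum_freq_sq]
  exact_mod_cast pow_ne_zero 2 (freqNorm_eq_zero.not.mpr hk)

/-- The pressure symbol is exactly the one that cancels the component along `k`. This keeps the
Taylor coefficients divergence free. -/
lemma sum_freq_mul_eulerSymbol (k : Fin d → ℤ) (S : Fin d → Fin d → ℂ) :
    ∑ i, (k i : ℂ) * eulerSymbol k S i = 0 := by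
  rcases eq_or_ne k 0 with rfl | hk
  · simp
  have h : ∑ i, (k i : ℂ) * eulerSymbol k S i
      = Complex.I * ((∑ a, ∑ b, (k a : ℂ) * (k b : ℂ) * S a b)
        + (∑ j, (k j : ℂ) ^ 2) * pressureSymbol k S) := by
    simp only [eulerSymbol_apply, Finset.mul_sum, Finset.sum_mul, mul_add, Finset.sum_add_distrib]
    congr 1
    · exact Finset.sum_congr rfl fun a _ => Finset.sum_congr rfl fun b _ => by ring
    · exact Finset.sum_congr rfl fun a _ => by ring
  rw [h, pressureSymbol, mul_neg, mul_div_cancel₀ _ (sum_freq_sq_ne_zero hk), add_neg_cancel,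
    mul_zero]

/-- The `k`-th coefficient of the projected nonlinearity `P (w · ∇) v`. -/
def nonlinearity (k : Fin d → ℤ) (w v : L2 d) : Vec d :=
  eulerSymbol k fun i j => productCoefficient k i j w v

/-- Bilinearity, in the form that makes the difference of two solutions satisfy a linear equation.
-/
lemma nonlinearity_sub (k : Fin d → ℤ) (w v w' v' : L2 d) :
    nonlinearity k w v - nonlinearity k w' v' =
      nonlinearity k (w - w') v + nonlinearity k w' (v - v') := by
  change eulerSymbolLinear k _ - eulerSymbolLinear k _
    = eulerSymbolLinear k _ + eulerSymbolLinear k _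
  rw [← map_sub, ← map_add]
  congr 1
  ext i j
  simp

lemma nonlinearity_smul_left (k : Fin d → ℤ) (c : ℂ) (w v : L2 d) :
    nonlinearity k (c • w) v = c • nonlinearity k w v := by
  change eulerSymbolLinear k _ = c • eulerSymbolLinear k _
  rw [← map_smul]
  congr 1
  ext i j
  simp

lemma nonlinearity_smul_right (k : Fin d → ℤ) (c : ℂ) (w v : L2 d) :
    nonlinearity k w (c • v) = c • nonlinearity k w v := by
  change eulerSymbolLinear k _ = c • eulerSymbolLinear k _
  rw [← map_smul]
  congr 1
  ext i j
  simp

/-- At a fixed frequency the derivative is only multiplication by `k`, so no regularity beyond `L²`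
is needed. The uniqueness proof rests on this. -/
lemma continuous_nonlinearity (k : Fin d → ℤ) :
    Continuous fun q : L2 d × L2 d => nonlinearity k q.1 q.2 := by
  have h : Continuous (eulerSymbolLinear k) := LinearMap.continuous_of_finiteDimensional _
  refine h.comp (continuous_pi fun i => continuous_pi fun j => ?_)
  exact (productCoefficient k i j).continuous₂

/-- Integration by parts: for divergence free `w`, `(w · ∇) v = div (v ⊗ w)` on the Fourier
side. -/
lemma sum_productCoefficient_weakPartial {w v : L2 d} {Dv : Fin d → L2 d}
    (hw : ∀ k : Fin d → ℤ, ∑ j, (k j : ℂ) * fourierCoefficient w k j = 0)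
    (hv : ∀ j, HasWeakPartial j v (Dv j)) (k : Fin d → ℤ) (i : Fin d) :
    ∑ j, productCoefficient k i j w (Dv j)
      = Complex.I * ∑ j, (k j : ℂ) * productCoefficient k i j w v := by
  have h1 := hasSum_sum (s := Finset.univ)
    fun j (_ : j ∈ Finset.univ) => hasSum_productCoefficient k i j w (Dv j)
  have h2 := (hasSum_sum (s := Finset.univ)
    fun j (_ : j ∈ Finset.univ) =>
      (hasSum_productCoefficient k i j w v).mul_left (k j : ℂ)).mul_left Complex.I
  refine h1.unique (h2.congr_fun fun m => ?_)
  -- The two sums differ by replacing `m` with `k` in the derivative factor; the discrepancy is `(k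
  -- - m) · ŵ(k - m)`, which vanishes.
  have h3 : ∑ j, ((k j : ℂ) - m j) * fourierCoefficient w (k - m) j = 0 := by
    simpa using hw (k - m)
  rw [← sub_eq_zero]
  calc _ = -(Complex.I * fourierCoefficient v m i *
        ∑ j, ((k j : ℂ) - m j) * fourierCoefficient w (k - m) j) := by
        simp only [Finset.mul_sum, ← Finset.sum_sub_distrib, ← Finset.sum_neg_distrib]
        refine Finset.sum_congr rfl fun j _ => ?_
        rw [(hv j).2.2 m, PiLp.smul_apply, smul_eq_mul]
        ring
    _ = 0 := by rw [h3, mul_zero, neg_zero]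

/-- The Fourier side of the transport equation, before the pressure is eliminated. -/
lemma fourierCoefficient_transport {v' w v : L2 d} {Dv : Fin d → L2 d} {p : Torus d → ℂ}
    {Dp : Fin d → Torus d → ℂ}
    (hw : ∀ k : Fin d → ℤ, ∑ j, (k j : ℂ) * fourierCoefficient w k j = 0)
    (hv : ∀ j, HasWeakPartial j v (Dv j)) (hp : ∀ j, HasWeakPartial j p (Dp j))
    (k : Fin d → ℤ) (i : Fin d) :
    fourierCoefficient (fun x => v' x i + ∑ j, w x j * Dv j x i + Dp i x) k =
      fourierCoefficient v' k i
        + Complex.I * (∑ j, (k j : ℂ) * productCoefficient k i j w v)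
        + Complex.I * (k i : ℂ) * fourierCoefficient p k := by
  have i1 : Integrable (fun x => v' x i) :=
    (integrable_scalarL2 (component i v')).congr (coeFn_component i v')
  have i2 : Integrable (fun x => ∑ j, w x j * Dv j x i) :=
    integrable_finsetSum _ fun j _ => integrable_mul_component w (Dv j) i j
  have i3 : Integrable (fun x => v' x i + ∑ j, w x j * Dv j x i) := i1.add i2
  rw [fourierCoefficient_add i3 (hp i).2.1,
    fourierCoefficient_add i1 i2,
    fourierCoefficient_sum _ fun j _ => integrable_mul_component w (Dv j) i j,
    ← sum_productCoefficient_weakPartial hw hv, (hp i).2.2 k, smul_eq_mul,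
    fourierCoefficient_apply v']
  simp only [productCoefficient_apply]

/-- A solution of the transport equation solves the ordinary differential equation for the Fourier
coefficients. -/
lemma TransportEq.fourierCoefficient_eq {v' w v : L2 d} {p : Torus d → ℂ}
    (h : TransportEq v' w v p) (hw : MemH w) (hv' : MemH v') (k : Fin d → ℤ) :
    fourierCoefficient v' k = -nonlinearity k w v := by
  rcases eq_or_ne k 0 with rfl | hk
  · rw [nonlinearity, eulerSymbol_zero_left, hv'.1, neg_zero]
  obtain ⟨Dv, Dp, hv, hp, heq⟩ := h
  have h1 : ∀ i, fourierCoefficient v' k i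
        + Complex.I * (∑ j, (k j : ℂ) * productCoefficient k i j w v)
        + Complex.I * (k i : ℂ) * fourierCoefficient p k = 0 := by
    intro i
    rw [← fourierCoefficient_transport hw.2 hv hp k i,
      fourierCoefficient_congr (g := fun _ => (0 : ℂ)) (heq.mono fun x hx => hx i)]
    simp [fourierCoefficient]
  have h2 : pressureSymbol k (fun i j => productCoefficient k i j w v)
      = fourierCoefficient p k := by
    -- Taking the product with `k` removes `v'`, which is divergence free, and leaves a scalar
    -- equation for the pressure coefficient.
    have h3 : ∑ i, (k i : ℂ) * (fourierCoefficient v' k i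
        + Complex.I * (∑ j, (k j : ℂ) * productCoefficient k i j w v)
        + Complex.I * (k i : ℂ) * fourierCoefficient p k) = 0 :=
      Finset.sum_eq_zero fun i _ => by rw [h1 i, mul_zero]
    have h4 : ∑ i, (k i : ℂ) * (fourierCoefficient v' k i
        + Complex.I * (∑ j, (k j : ℂ) * productCoefficient k i j w v)
        + Complex.I * (k i : ℂ) * fourierCoefficient p k) =
        (∑ i, (k i : ℂ) * fourierCoefficient v' k i)
        + Complex.I * ((∑ a, ∑ b, (k a : ℂ) * (k b : ℂ) * productCoefficient k a b w v)
          + (∑ j, (k j : ℂ) ^ 2) * fourierCoefficient p k) := by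
      simp only [Finset.mul_sum, Finset.sum_mul, mul_add, Finset.sum_add_distrib]
      rw [add_assoc]
      congr 2
      · exact Finset.sum_congr rfl fun a _ => Finset.sum_congr rfl fun b _ => by ring
      · exact Finset.sum_congr rfl fun a _ => by ring
    rw [h4, hv'.2 k, zero_add, mul_eq_zero] at h3
    have h5 := h3.resolve_left Complex.I_ne_zero
    rw [pressureSymbol, ← neg_div, div_eq_iff (sum_freq_sq_ne_zero hk)]
    linear_combination -h5
  ext i
  rw [PiLp.neg_apply, nonlinearity, eulerSymbol_apply, h2]
  linear_combination h1 i

/-- Conversely, the equation for the Fourier coefficients implies the transport equation, for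
regular enough fields. -/
lemma transportEq_of_fourierCoefficient {v' w v : L2 d} {Dv : Fin d → L2 d} {p : Torus d → ℂ}
    {Dp : Fin d → Torus d → ℂ} {M : ℝ} (hw : MemH w) (hM : ∀ᵐ x, ‖w x‖ ≤ M)
    (hv : ∀ j, HasWeakPartial j v (Dv j)) (hp : ∀ j, HasWeakPartial j p (Dp j))
    (hDp : ∀ j, MemLp (Dp j) 2)
    (hpk : ∀ k, fourierCoefficient p k =
      pressureSymbol k fun i j => productCoefficient k i j w v)
    (h : ∀ k, fourierCoefficient v' k = -nonlinearity k w v) :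
    TransportEq v' w v p := by
  refine ⟨Dv, Dp, hv, hp, ?_⟩
  rw [ae_all_iff]
  intro i
  have m1 : ∀ (u : L2 d) (j : Fin d), MemLp (fun x => u x j) 2 := fun u j =>
    (Lp.memLp (component j u)).ae_eq (coeFn_component j u)
  -- The sup bound on `w` puts the residual of the equation in `L²`, where vanishing Fourier
  -- coefficients force it to be zero.
  have m2 : ∀ j, MemLp (fun x => w x j * Dv j x i) 2 := by
    intro j
    refine MemLp.of_le_mul (c := M) (m1 (Dv j) i)
      ((m1 w j).aestronglyMeasurable.mul (m1 (Dv j) i).aestronglyMeasurable) ?_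
    filter_upwards [hM] with x hx
    rw [norm_mul]
    gcongr
    exact (PiLp.norm_apply_le (w x) j).trans hx
  have hF : MemLp (fun x => v' x i + ∑ j, w x j * Dv j x i + Dp i x) 2 :=
    ((m1 v' i).add (memLp_finsetSum _ fun j _ => m2 j)).add (hDp i)
  have h0 : hF.toLp = 0 := by
    apply eq_zero_of_fourierCoefficient_eq_zero
    intro k
    rw [fourierCoefficient_congr hF.coeFn_toLp, fourierCoefficient_transport hw.2 hv hp, h, hpk,
      PiLp.neg_apply, nonlinearity, eulerSymbol_apply]
    ring
  filter_upwards [hF.coeFn_toLp, Lp.eq_zero_iff_ae_eq_zero.mp h0] with x h1 h2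
  rw [← h1, h2]; rfl

/-- Exchanging the fields transposes the matrix `(w_j v_i)^(k)`, and `k_a k_b` is symmetric. Hence
one pressure serves both equations. -/
lemma pressureSymbol_swap (k : Fin d → ℤ) (w v : L2 d) :
    pressureSymbol k (fun i j => productCoefficient k i j w v)
      = pressureSymbol k (fun i j => productCoefficient k i j v w) := by
  unfold pressureSymbol
  congr 2
  rw [Finset.sum_comm]
  refine Finset.sum_congr rfl fun a _ => Finset.sum_congr rfl fun b _ => ?_
  simp only [productCoefficient_apply, mul_comm]

attribute [irreducible] nonlinearity

end Symbol

/-! ### Uniqueness by comparison of leading Taylor terms -/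

section Uniqueness

variable {d : ℕ}

/-- The time derivative of a curve in `H_ℂ` lies in `H_ℂ`. -/
lemma memH_of_hasDerivAt {v : ℂ → L2 d} {v' : L2 d} {ζ : ℂ} (hv : ∀ᶠ z in 𝓝 ζ, MemH (v z))
    (h : HasDerivAt v v' ζ) : MemH v' := by
  have hk : ∀ k : Fin d → ℤ, HasDerivAt (fun z => coefficientL k (v z)) (coefficientL k v') ζ :=
    fun k => (coefficientL k).hasFDerivAt.comp_hasDerivAt ζ h
  constructor
  · rw [← coefficientL_apply]
    refine (hk 0).unique ((hasDerivAt_const ζ (0 : Vec d)).congr_of_eventuallyEq ?_)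
    filter_upwards [hv] with z hz
    rw [coefficientL_apply, hz.1]
  · intro k
    have h1 : HasDerivAt (fun z => ∑ j, (k j : ℂ) * coefficientL k (v z) j)
        (∑ j, (k j : ℂ) * coefficientL k v' j) ζ := by
      refine HasDerivAt.fun_sum fun j _ => HasDerivAt.const_mul _ ?_
      exact (EuclideanSpace.proj j : Vec d →L[ℂ] ℂ).hasFDerivAt.comp_hasDerivAt ζ (hk k)
    rw [← coefficientL_apply]
    refine h1.unique ((hasDerivAt_const ζ (0 : ℂ)).congr_of_eventuallyEq ?_)
    filter_upwards [hv] with z hz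
    rw [coefficientL_apply, hz.2 k]

/-- The Fourier coefficients of a solution solve an ordinary differential equation. -/
lemma IsSolution.hasDerivAt_coefficient {R : Set ℂ} (hR : IsOpen R) {v₀ w₀ : L2 d}
    {v w : ℂ → L2 d} (h : IsSolution R v₀ w₀ v w) {ζ : ℂ} (hζ : ζ ∈ R) (k : Fin d → ℤ) :
    HasDerivAt (fun z => coefficientL k (v z)) (-nonlinearity k (w ζ) (v ζ)) ζ ∧
    HasDerivAt (fun z => coefficientL k (w z)) (-nonlinearity k (v ζ) (w ζ)) ζ := by
  obtain ⟨v', w', p, hv, hw, ev, ew⟩ := h.equation ζ hζ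
  have hn := hR.mem_nhds hζ
  constructor
  · rw [← ev.fourierCoefficient_eq (h.mem_right ζ hζ)
      (memH_of_hasDerivAt (Filter.eventually_of_mem hn h.mem_left) hv), ← coefficientL_apply]
    exact (coefficientL k).hasFDerivAt.comp_hasDerivAt ζ hv
  · rw [← ew.fourierCoefficient_eq (h.mem_left ζ hζ)
      (memH_of_hasDerivAt (Filter.eventually_of_mem hn h.mem_right) hw), ← coefficientL_apply]
    exact (coefficientL k).hasFDerivAt.comp_hasDerivAt ζ hw

lemma tendsto_nonlinearity {ι : Type*} {l : Filter ι} {f g : ι → L2 d} {a b : L2 d}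
    (k : Fin d → ℤ) (hf : Tendsto f l (𝓝 a)) (hg : Tendsto g l (𝓝 b)) :
    Tendsto (fun z => nonlinearity k (f z) (g z)) l (𝓝 (nonlinearity k a b)) :=
  Tendsto.comp (g := fun q : L2 d × L2 d => nonlinearity k q.1 q.2) (f := fun z => (f z, g z))
    (y := 𝓝 (a, b)) ((continuous_nonlinearity k).tendsto (a, b)) (hf.prodMk_nhds hg)

/-- The leading Taylor coefficient of the difference of two solutions vanishes. -/
lemma coefficientL_leading_eq_zero {v v₁ w w₁ g₁ g₂ : ℂ → L2 d} {a b : L2 d} {n : ℕ} (hn : n ≠ 0)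
    (k : Fin d → ℤ) (hv : Tendsto v (𝓝[≠] 0) (𝓝 a)) (hw : Tendsto w₁ (𝓝[≠] 0) (𝓝 b))
    (hg₁ : AnalyticAt ℂ g₁ 0) (hg₂ : ContinuousAt g₂ 0)
    (e₁ : ∀ᶠ z in 𝓝 (0 : ℂ), z ≠ 0 → v z - v₁ z = z ^ n • g₁ z)
    (e₂ : ∀ᶠ z in 𝓝 (0 : ℂ), z ≠ 0 → w z - w₁ z = z ^ n • g₂ z)
    (o : ∀ᶠ z in 𝓝[≠] (0 : ℂ),
      HasDerivAt (fun z => coefficientL k (v z)) (-nonlinearity k (w z) (v z)) z)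
    (o₁ : ∀ᶠ z in 𝓝[≠] (0 : ℂ),
      HasDerivAt (fun z => coefficientL k (v₁ z)) (-nonlinearity k (w₁ z) (v₁ z)) z) :
    coefficientL k (g₁ 0) = 0 := by
  obtain ⟨m, rfl⟩ := Nat.exists_eq_succ_of_ne_zero hn
  set c : ℂ → Vec d := fun z => coefficientL k (g₁ z) with hc
  have hcan : AnalyticAt ℂ c 0 := ((coefficientL k).analyticAt _).comp hg₁
  have hid : Tendsto (fun z : ℂ => z) (𝓝[≠] 0) (𝓝 0) := tendsto_id.mono_left nhdsWithin_le_nhds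
  -- This is the equation for `z^{m+1} c(z)` divided by `z^m`. The right side keeps a factor `z`, so
  -- only `(m + 1) c(0)` survives as `z → 0`.
  have key : ∀ᶠ z in 𝓝[≠] (0 : ℂ), ((m + 1 : ℕ) : ℂ) • c z =
      -(z • (deriv c z + (nonlinearity k (g₂ z) (v z) + nonlinearity k (w₁ z) (g₁ z)))) := by
    -- The factorisation is differentiated, so it must hold in a neighbourhood of `z` and not only
    -- at `z`.
    have e₁' := eventually_nhdsWithin_of_eventually_nhds (s := {0}ᶜ)
      (eventually_eventually_nhds.mpr e₁)
    have hd := eventually_nhdsWithin_of_eventually_nhds (s := {(0 : ℂ)}ᶜ)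
      (hcan.eventually_analyticAt)
    filter_upwards [e₁', eventually_nhdsWithin_of_eventually_nhds e₂, o, o₁, hd,
      self_mem_nhdsWithin] with z h1 h2 h3 h4 h5 hz
    have hz0 : z ≠ 0 := hz
    have d1 := h3.sub h4
    have d2 : HasDerivAt (fun z => z ^ (m + 1) • c z)
        (z ^ (m + 1) • deriv c z + (((m + 1 : ℕ) : ℂ) * z ^ m) • c z) z := by
      have := (hasDerivAt_pow (m + 1) z).smul h5.differentiableAt.hasDerivAt
      simpa using! this
    have heq : ((fun z => coefficientL k (v z)) - fun z => coefficientL k (v₁ z)) =ᶠ[𝓝 z]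
        fun z => z ^ (m + 1) • c z := by
      filter_upwards [h1, isOpen_ne.mem_nhds hz0] with y hy hy0
      rw [Pi.sub_apply, ← map_sub, hy hy0, map_smul]
    have h6 := d1.unique (d2.congr_of_eventuallyEq heq)
    have h7 : -nonlinearity k (w z) (v z) - -nonlinearity k (w₁ z) (v₁ z)
        = -(z ^ (m + 1) • (nonlinearity k (g₂ z) (v z) + nonlinearity k (w₁ z) (g₁ z))) := by
      rw [neg_sub_neg, ← neg_sub, nonlinearity_sub, h2 hz0, h1.self_of_nhds hz0,
        nonlinearity_smul_left, nonlinearity_smul_right, smul_add]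
    rw [h7] at h6
    have h8 : z ^ m ≠ 0 := pow_ne_zero _ hz0
    apply smul_right_injective _ h8
    dsimp only
    rw [smul_smul, mul_comm (z ^ m), smul_neg, smul_smul, ← pow_succ, smul_add, neg_add, h6]
    abel
  have t1 : Tendsto (fun z => ((m + 1 : ℕ) : ℂ) • c z) (𝓝[≠] 0) (𝓝 (((m + 1 : ℕ) : ℂ) • c 0)) :=
    (hcan.continuousAt.tendsto.mono_left nhdsWithin_le_nhds).const_smul _
  have t2 : Tendsto (fun z => -(z • (deriv c z +
      (nonlinearity k (g₂ z) (v z) + nonlinearity k (w₁ z) (g₁ z))))) (𝓝[≠] 0)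
      (𝓝 (-((0 : ℂ) • (deriv c 0 + (nonlinearity k (g₂ 0) a + nonlinearity k b (g₁ 0)))))) := by
    have s1 : Tendsto (deriv c) (𝓝[≠] 0) (𝓝 (deriv c 0)) :=
      hcan.deriv.continuousAt.tendsto.mono_left nhdsWithin_le_nhds
    have s2 := tendsto_nonlinearity k (hg₂.tendsto.mono_left nhdsWithin_le_nhds) hv
    have s3 := tendsto_nonlinearity k hw
      (hg₁.continuousAt.tendsto.mono_left nhdsWithin_le_nhds)
    exact (hid.smul (s1.add (s2.add s3))).neg
  have h := tendsto_nhds_unique (t1.congr' key) t2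
  rw [zero_smul, neg_zero, smul_eq_zero] at h
  exact h.resolve_left (by exact_mod_cast Nat.succ_ne_zero m)

/-- Two solutions on a punctured domain with the same limit at `0` coincide. -/
theorem IsSolution.eqOn {D : Set ℂ} (hD : IsOpen D) (hc : IsPreconnected D) (h0 : (0 : ℂ) ∈ D)
    {v₀ w₀ : L2 d} {v w v₁ w₁ : ℂ → L2 d} (h : IsSolution (D \ {0}) v₀ w₀ v w)
    (h₁ : IsSolution (D \ {0}) v₀ w₀ v₁ w₁) {ζ : ℂ} (hζ : ζ ∈ D \ {0}) :
    v₁ ζ = v ζ ∧ w₁ ζ = w ζ := by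
  classical
  have hR : IsOpen (D \ {0}) := hD.sdiff isClosed_singleton
  have hnhds : 𝓝[D \ {0}] (0 : ℂ) = 𝓝[≠] 0 := by
    rw [Set.sdiff_eq, Set.inter_comm, nhdsWithin_inter_of_mem']
    exact nhdsWithin_le_nhds (hD.mem_nhds h0)
  have hmem : ∀ᶠ z in 𝓝[≠] (0 : ℂ), z ∈ D \ {0} := hnhds ▸ self_mem_nhdsWithin
  set F : ℂ → L2 d × L2 d := Function.update (fun z => (v z - v₁ z, w z - w₁ z)) 0 0 with hF
  have hFne : ∀ z ≠ 0, F z = (v z - v₁ z, w z - w₁ z) := fun z hz =>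
    Function.update_of_ne hz _ _
  have hF0 : F 0 = 0 := Function.update_self ..
  -- Removable singularity: both solutions have the same limits at `0`, so `F` is continuous there
  -- with value `0`.
  have hdiff : DifferentiableOn ℂ F D := by
    rw [← Complex.differentiableOn_compl_singleton_and_continuousAt_iff (hD.mem_nhds h0)]
    constructor
    · intro z hz
      obtain ⟨v', w', _, hv, hw, -, -⟩ := h.equation z hz
      obtain ⟨v₁', w₁', _, hv₁, hw₁, -, -⟩ := h₁.equation z hz
      refine DifferentiableAt.differentiableWithinAt ?_
      refine (((hv.differentiableAt.sub hv₁.differentiableAt).prodMk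
        (hw.differentiableAt.sub hw₁.differentiableAt))).congr_of_eventuallyEq ?_
      filter_upwards [isOpen_ne.mem_nhds hz.2] with y hy
      exact hFne y hy
    · rw [continuousAt_update_same, ← hnhds]
      have := (h.initial_left.sub h₁.initial_left).prodMk_nhds
        (h.initial_right.sub h₁.initial_right)
      simpa using! this
  have han := hdiff.analyticOnNhd hD
  have hev : ∀ᶠ z in 𝓝 (0 : ℂ), F z = 0 := by
    by_contra hne
    obtain ⟨n, g, hg, hg0, hgn⟩ := (han 0 h0).exists_eventuallyEq_pow_smul_nonzero_iff.mpr hne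
    -- The order of vanishing is at least one because `F 0 = 0` while `g 0 ≠ 0`.
    have hn : n ≠ 0 := by
      rintro rfl
      have := hgn.self_of_nhds
      rw [hF0, pow_zero, one_smul] at this
      exact hg0 this.symm
    have hg₁ : AnalyticAt ℂ (fun z => (g z).1) 0 := analyticAt_fst.comp hg
    have hg₂ : AnalyticAt ℂ (fun z => (g z).2) 0 := analyticAt_snd.comp hg
    have e₁ : ∀ᶠ z in 𝓝 (0 : ℂ), z ≠ 0 → v z - v₁ z = z ^ n • (g z).1 := by
      filter_upwards [hgn] with z hz hz0
      rw [hFne z hz0, sub_zero] at hz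
      exact congrArg Prod.fst hz
    have e₂ : ∀ᶠ z in 𝓝 (0 : ℂ), z ≠ 0 → w z - w₁ z = z ^ n • (g z).2 := by
      filter_upwards [hgn] with z hz hz0
      rw [hFne z hz0, sub_zero] at hz
      exact congrArg Prod.snd hz
    have tv := h.initial_left
    have tw := h.initial_right
    have tv₁ := h₁.initial_left
    have tw₁ := h₁.initial_right
    rw [hnhds] at tv tw tv₁ tw₁
    have hv0 : (g 0).1 = 0 := L2_eq_zero_of_fourierCoefficient_eq_zero _ fun k => by
      rw [← coefficientL_apply]
      exact coefficientL_leading_eq_zero (g₁ := fun z => (g z).1) (g₂ := fun z => (g z).2)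
        hn k tv tw₁ hg₁ hg₂.continuousAt e₁ e₂
        (hmem.mono fun z hz => (h.hasDerivAt_coefficient hR hz k).1)
        (hmem.mono fun z hz => (h₁.hasDerivAt_coefficient hR hz k).1)
    have hw0 : (g 0).2 = 0 := L2_eq_zero_of_fourierCoefficient_eq_zero _ fun k => by
      rw [← coefficientL_apply]
      exact coefficientL_leading_eq_zero (g₁ := fun z => (g z).2) (g₂ := fun z => (g z).1)
        hn k tw tv₁ hg₂ hg₁.continuousAt e₂ e₁
        (hmem.mono fun z hz => (h.hasDerivAt_coefficient hR hz k).2)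
        (hmem.mono fun z hz => (h₁.hasDerivAt_coefficient hR hz k).2)
    exact hg0 (Prod.ext hv0 hw0)
  have hzero := han.eqOn_zero_of_preconnected_of_eventuallyEq_zero hc h0 hev hζ.1
  rw [hFne ζ hζ.2] at hzero
  have ha := congrArg Prod.fst hzero
  have hb := congrArg Prod.snd hzero
  exact ⟨(sub_eq_zero.mp ha).symm, (sub_eq_zero.mp hb).symm⟩

end Uniqueness

/-! ### Wiener norms and the Cauchy–Kovalevskaya majorant -/

section Sequences

variable {d : ℕ}

lemma freqNorm_eq_norm (k : Fin d → ℤ) :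
    freqNorm k = ‖(WithLp.toLp 2 fun j => (k j : ℝ) : EuclideanSpace ℝ (Fin d))‖ := by
  simp [freqNorm, EuclideanSpace.norm_eq]

lemma freqNorm_add_le (k m : Fin d → ℤ) : freqNorm (k + m) ≤ freqNorm k + freqNorm m := by
  simp only [freqNorm_eq_norm]
  refine le_trans (le_of_eq ?_) (norm_add_le _ _)
  congr 1
  ext j
  simp

lemma norm_freq_le (k : Fin d → ℤ) (j : Fin d) : ‖(k j : ℂ)‖ ≤ freqNorm k := by
  rw [freqNorm_eq_norm]
  refine le_trans (le_of_eq ?_)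
    (PiLp.norm_apply_le (WithLp.toLp 2 fun j => (k j : ℝ) : EuclideanSpace ℝ (Fin d)) j)
  simp

lemma norm_vec_le_sum (x : Vec d) : ‖x‖ ≤ ∑ i, ‖x i‖ := by
  rw [EuclideanSpace.norm_eq]
  have h : 0 ≤ ∑ i, ‖x i‖ := Finset.sum_nonneg fun i _ => norm_nonneg _
  exact Real.sqrt_le_iff.mpr ⟨h, Finset.sum_sq_le_sq_sum_of_nonneg fun i _ => norm_nonneg _⟩

lemma norm_pressureSymbol_le (k : Fin d → ℤ) (S : Fin d → Fin d → ℂ) :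
    ‖pressureSymbol k S‖ ≤ ∑ i, ∑ j, ‖S i j‖ := by
  have hS : 0 ≤ ∑ i, ∑ j, ‖S i j‖ := by positivity
  rcases eq_or_ne k 0 with rfl | hk
  · simpa [pressureSymbol] using hS
  have hk' : 0 < freqNorm k ^ 2 :=
    pow_pos ((freqNorm_nonneg k).lt_of_ne' (freqNorm_eq_zero.not.mpr hk)) 2
  rw [pressureSymbol, norm_neg, norm_div, sum_freq_sq, Complex.norm_real,
    Real.norm_of_nonneg hk'.le, div_le_iff₀ hk', Finset.sum_mul]
  refine (norm_sum_le _ _).trans (Finset.sum_le_sum fun a _ => ?_)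
  rw [Finset.sum_mul]
  refine (norm_sum_le _ _).trans (Finset.sum_le_sum fun b _ => ?_)
  rw [norm_mul, norm_mul, mul_comm, sq]
  refine mul_le_mul_of_nonneg_left ?_ (norm_nonneg _)
  exact mul_le_mul (norm_freq_le k a) (norm_freq_le k b) (norm_nonneg _) (freqNorm_nonneg k)

/-- The projection has order zero because `|k_a k_b| ≤ |k|²`, so the only growth is the one factor
`|k|` of the divergence. -/
lemma norm_eulerSymbol_le (k : Fin d → ℤ) (S : Fin d → Fin d → ℂ) :
    ‖eulerSymbol k S‖ ≤ 2 * d * freqNorm k * ∑ i, ∑ j, ‖S i j‖ := by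
  have h : ∀ i, ‖eulerSymbol k S i‖ ≤ 2 * freqNorm k * ∑ i, ∑ j, ‖S i j‖ := by
    intro i
    rw [eulerSymbol_apply]
    refine (norm_add_le _ _).trans ?_
    have h1 : ‖Complex.I * ∑ j, (k j : ℂ) * S i j‖ ≤ freqNorm k * ∑ i, ∑ j, ‖S i j‖ := by
      rw [norm_mul, Complex.norm_I, one_mul]
      calc _ ≤ ∑ j, ‖(k j : ℂ) * S i j‖ := norm_sum_le _ _
        _ ≤ ∑ j, freqNorm k * ‖S i j‖ := Finset.sum_le_sum fun j _ => by
            rw [norm_mul]; gcongr; exact norm_freq_le k j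
        _ = freqNorm k * ∑ j, ‖S i j‖ := by rw [Finset.mul_sum]
        _ ≤ _ := by
            refine mul_le_mul_of_nonneg_left ?_ (freqNorm_nonneg k)
            exact Finset.single_le_sum (f := fun i => ∑ j, ‖S i j‖)
              (fun i _ => Finset.sum_nonneg fun j _ => norm_nonneg _) (Finset.mem_univ i)
    have h2 : ‖Complex.I * (k i : ℂ) * pressureSymbol k S‖ ≤
        freqNorm k * ∑ i, ∑ j, ‖S i j‖ := by
      rw [norm_mul, norm_mul, Complex.norm_I, one_mul]
      exact mul_le_mul (norm_freq_le k i) (norm_pressureSymbol_le k S) (norm_nonneg _)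
        (freqNorm_nonneg k)
    linarith
  calc _ ≤ ∑ i, ‖eulerSymbol k S i‖ := norm_vec_le_sum _
    _ ≤ ∑ i : Fin d, 2 * freqNorm k * ∑ i, ∑ j, ‖S i j‖ := Finset.sum_le_sum fun i _ => h i
    _ = _ := by rw [Finset.sum_const, Finset.card_univ, Fintype.card_fin, nsmul_eq_mul]; ring

/-- The convolution of two sequences of vectors, as a matrix. -/
def convolution (b a : (Fin d → ℤ) → Vec d) (k : Fin d → ℤ) (i j : Fin d) : ℂ :=
  ∑' m, b (k - m) j * a m i

/-- The projected nonlinearity on sequences of Fourier coefficients. -/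
def sequenceNonlinearity (b a : (Fin d → ℤ) → Vec d) (k : Fin d → ℤ) : Vec d :=
  eulerSymbol k (convolution b a k)

/-- The weighted Wiener norm `∑ e^{β|k|} |a(k)|`. -/
def wiener {F : Type*} [NormedAddCommGroup F] (β : ℝ) (a : (Fin d → ℤ) → F) : ℝ≥0∞ :=
  ∑' k, ENNReal.ofReal (Real.exp (β * freqNorm k)) * ‖a k‖ₑ

lemma wiener_mono {F : Type*} [NormedAddCommGroup F] {β γ : ℝ} (h : β ≤ γ)
    (a : (Fin d → ℤ) → F) : wiener β a ≤ wiener γ a := by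
  refine ENNReal.tsum_le_tsum fun k => ?_
  gcongr
  exact freqNorm_nonneg k

lemma wiener_add_le {F : Type*} [NormedAddCommGroup F] (β : ℝ) (a b : (Fin d → ℤ) → F) :
    wiener β (a + b) ≤ wiener β a + wiener β b := by
  unfold wiener
  rw [← ENNReal.tsum_add]
  refine ENNReal.tsum_le_tsum fun k => ?_
  rw [← mul_add]
  gcongr
  exact enorm_add_le _ _

lemma wiener_zero {F : Type*} [NormedAddCommGroup F] (β : ℝ) :
    wiener β (0 : (Fin d → ℤ) → F) = 0 := by
  simp [wiener]

lemma wiener_sum_le {F ι : Type*} [NormedAddCommGroup F] (β : ℝ) (s : Finset ι)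
    (a : ι → (Fin d → ℤ) → F) : wiener β (∑ i ∈ s, a i) ≤ ∑ i ∈ s, wiener β (a i) :=
  Finset.le_sum_of_subadditive _ (wiener_zero β).le (wiener_add_le β) s a

lemma wiener_smul {F : Type*} [NormedAddCommGroup F] [NormedSpace ℂ F] (β : ℝ) (c : ℂ)
    (a : (Fin d → ℤ) → F) : wiener β (c • a) = ‖c‖ₑ * wiener β a := by
  unfold wiener
  rw [← ENNReal.tsum_mul_left]
  refine tsum_congr fun k => ?_
  rw [Pi.smul_apply, enorm_smul, mul_left_comm]

lemma enorm_convolution_le (b a : (Fin d → ℤ) → Vec d) (k : Fin d → ℤ) (i j : Fin d) :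
    ‖convolution b a k i j‖ₑ ≤ ∑' m, ‖b (k - m)‖ₑ * ‖a m‖ₑ := by
  refine enorm_tsum_le_tsum_enorm.trans (ENNReal.tsum_le_tsum fun m => ?_)
  rw [enorm_mul]
  gcongr
  · exact enorm_le_iff_norm_le.mpr (PiLp.norm_apply_le (b (k - m)) j)
  · exact enorm_le_iff_norm_le.mpr (PiLp.norm_apply_le (a m) i)

/-- The constant of the bilinear estimate. -/
def bilinearConst (d : ℕ) : ℝ := 2 * d ^ 3

lemma bilinearConst_nonneg (d : ℕ) : 0 ≤ bilinearConst d := by unfold bilinearConst; positivity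

/-- The constant `2 d³` is `2 d` from `norm_eulerSymbol_le` times the `d²` entries of the
convolution matrix. -/
lemma enorm_sequenceNonlinearity_le (b a : (Fin d → ℤ) → Vec d) (k : Fin d → ℤ) :
    ‖sequenceNonlinearity b a k‖ₑ ≤
      ENNReal.ofReal (bilinearConst d * freqNorm k) * ∑' m, ‖b (k - m)‖ₑ * ‖a m‖ₑ := by
  have h1 : ‖sequenceNonlinearity b a k‖ₑ ≤ ENNReal.ofReal (2 * d * freqNorm k) *
      ∑ i, ∑ j, ‖convolution b a k i j‖ₑ := by
    have hk := freqNorm_nonneg k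
    have := ENNReal.ofReal_le_ofReal (norm_eulerSymbol_le k (convolution b a k))
    rw [ofReal_norm, ENNReal.ofReal_mul (by positivity),
      ENNReal.ofReal_sum_of_nonneg fun i _ => Finset.sum_nonneg fun j _ => norm_nonneg _] at this
    simpa only [ENNReal.ofReal_sum_of_nonneg fun (j : Fin d) _ => norm_nonneg _, ofReal_norm]
      using! this
  refine h1.trans ?_
  have h2 : ∑ i, ∑ j, ‖convolution b a k i j‖ₑ ≤
      ENNReal.ofReal ((d : ℝ) ^ 2) * ∑' m, ‖b (k - m)‖ₑ * ‖a m‖ₑ := by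
    refine (Finset.sum_le_sum fun i _ => Finset.sum_le_sum fun j _ =>
      enorm_convolution_le b a k i j).trans (le_of_eq ?_)
    simp only [Finset.sum_const, Finset.card_univ, Fintype.card_fin, nsmul_eq_mul]
    rw [← mul_assoc, ENNReal.ofReal_pow (by positivity), ENNReal.ofReal_natCast, sq]
  refine (mul_le_mul_right h2 _).trans (le_of_eq ?_)
  rw [← mul_assoc, ← ENNReal.ofReal_mul (by have := freqNorm_nonneg k; positivity)]
  congr 2
  unfold bilinearConst
  ring

/-- The Wiener norm is submultiplicative under convolution. -/
lemma tsum_weight_mul_convolution_le {γ : ℝ} (hγ : 0 ≤ γ) (b a : (Fin d → ℤ) → Vec d) :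
    ∑' k, ENNReal.ofReal (Real.exp (γ * freqNorm k)) * ∑' m, ‖b (k - m)‖ₑ * ‖a m‖ₑ ≤
      wiener γ b * wiener γ a := by
  set f : (Fin d → ℤ) → ℝ≥0∞ := fun k => ENNReal.ofReal (Real.exp (γ * freqNorm k)) * ‖b k‖ₑ
  set g : (Fin d → ℤ) → ℝ≥0∞ := fun k => ENNReal.ofReal (Real.exp (γ * freqNorm k)) * ‖a k‖ₑ
  have hterm : ∀ k, ENNReal.ofReal (Real.exp (γ * freqNorm k)) * ∑' m, ‖b (k - m)‖ₑ * ‖a m‖ₑ ≤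
      ∑' m, f (k - m) * g m := by
    intro k
    rw [← ENNReal.tsum_mul_left]
    refine ENNReal.tsum_le_tsum fun m => ?_
    have h2 : ENNReal.ofReal (Real.exp (γ * freqNorm k)) ≤
        ENNReal.ofReal (Real.exp (γ * freqNorm (k - m))) *
          ENNReal.ofReal (Real.exp (γ * freqNorm m)) := by
      rw [← ENNReal.ofReal_mul (Real.exp_pos _).le, ← Real.exp_add, ← mul_add]
      gcongr
      simpa using freqNorm_add_le (k - m) m
    calc _ ≤ (ENNReal.ofReal (Real.exp (γ * freqNorm (k - m))) *
          ENNReal.ofReal (Real.exp (γ * freqNorm m))) * (‖b (k - m)‖ₑ * ‖a m‖ₑ) := by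
          gcongr
      _ = _ := by simp only [f, g]; ring
  calc _ ≤ ∑' k, ∑' m, f (k - m) * g m := ENNReal.tsum_le_tsum hterm
    _ = ∑' m, ∑' k, f (k - m) * g m := ENNReal.tsum_comm
    _ = _ := by
        have : ∀ m, ∑' k, f (k - m) * g m = (∑' k, f k) * g m := fun m => by
          rw [ENNReal.tsum_mul_right]
          congr 1
          exact (Equiv.subRight m).tsum_eq f
        simp only [this, ENNReal.tsum_mul_left]
        rfl

/-- The nonlinearity loses one derivative, that is a factor `1 / ε` for a loss of `ε` in the
exponential weight. -/
lemma wiener_sequenceNonlinearity_le {β ε : ℝ} (hε : 0 < ε) (hβ : 0 ≤ β + ε)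
    (b a : (Fin d → ℤ) → Vec d) :
    wiener β (sequenceNonlinearity b a) ≤
      ENNReal.ofReal (bilinearConst d / ε) * (wiener (β + ε) b * wiener (β + ε) a) := by
  refine le_trans ?_ (mul_le_mul_right (tsum_weight_mul_convolution_le hβ b a) _)
  rw [← ENNReal.tsum_mul_left]
  refine ENNReal.tsum_le_tsum fun k => ?_
  have hB := bilinearConst_nonneg d
  calc _ ≤ ENNReal.ofReal (Real.exp (β * freqNorm k)) *
        (ENNReal.ofReal (bilinearConst d * freqNorm k) * ∑' m, ‖b (k - m)‖ₑ * ‖a m‖ₑ) := by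
        gcongr; exact enorm_sequenceNonlinearity_le b a k
    _ ≤ _ := by
        rw [← mul_assoc, ← mul_assoc, ← ENNReal.ofReal_mul (Real.exp_pos _).le,
          ← ENNReal.ofReal_mul (by positivity)]
        refine mul_le_mul_left (ENNReal.ofReal_le_ofReal ?_) _
        -- The factor `|k|` is absorbed by the extra exponential weight, at the price `1 / ε`.
        have h1 : ε * freqNorm k ≤ Real.exp (ε * freqNorm k) :=
          (by linarith : ε * freqNorm k ≤ ε * freqNorm k + 1).trans (Real.add_one_le_exp _)
        rw [add_mul, Real.exp_add]
        calc Real.exp (β * freqNorm k) * (bilinearConst d * freqNorm k)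
            = bilinearConst d / ε * (Real.exp (β * freqNorm k) * (ε * freqNorm k)) := by
              field_simp
          _ ≤ _ := by gcongr

/-- The Fourier coefficients of the Taylor coefficients (in time) of the solution. -/
def taylor (a₀ b₀ : (Fin d → ℤ) → Vec d) :
    ℕ → ((Fin d → ℤ) → Vec d) × ((Fin d → ℤ) → Vec d)
  | 0 => (a₀, b₀)
  | n + 1 => -((n : ℂ) + 1)⁻¹ • ∑ i : Fin n.succ,
      (sequenceNonlinearity (taylor a₀ b₀ i).2 (taylor a₀ b₀ (n - i)).1,
        sequenceNonlinearity (taylor a₀ b₀ i).1 (taylor a₀ b₀ (n - i)).2)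

lemma taylor_zero (a₀ b₀ : (Fin d → ℤ) → Vec d) : taylor a₀ b₀ 0 = (a₀, b₀) := by rw [taylor]

lemma taylor_succ_fst (a₀ b₀ : (Fin d → ℤ) → Vec d) (n : ℕ) : (taylor a₀ b₀ (n + 1)).1 =
    -((n : ℂ) + 1)⁻¹ • ∑ i : Fin n.succ,
      sequenceNonlinearity (taylor a₀ b₀ i).2 (taylor a₀ b₀ (n - i)).1 := by
  rw [taylor, Prod.smul_fst, Prod.fst_sum]

lemma taylor_succ_snd (a₀ b₀ : (Fin d → ℤ) → Vec d) (n : ℕ) : (taylor a₀ b₀ (n + 1)).2 =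
    -((n : ℂ) + 1)⁻¹ • ∑ i : Fin n.succ,
      sequenceNonlinearity (taylor a₀ b₀ i).1 (taylor a₀ b₀ (n - i)).2 := by
  rw [taylor, Prod.smul_snd, Prod.snd_sum]

/-- One step of the recursion. Adding the norms of the two fields gives a single scalar majorant `M`
for the coupled system. -/
lemma wiener_taylor_succ_le (a₀ b₀ : (Fin d → ℤ) → Vec d) (n : ℕ) {β ε : ℝ} (hε : 0 < ε)
    (hβ : 0 ≤ β + ε) {M : ℕ → ℝ≥0∞}
    (hM : ∀ i ≤ n, wiener (β + ε) (taylor a₀ b₀ i).1 + wiener (β + ε) (taylor a₀ b₀ i).2 ≤ M i) :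
    wiener β (taylor a₀ b₀ (n + 1)).1 + wiener β (taylor a₀ b₀ (n + 1)).2 ≤
      ENNReal.ofReal (((n : ℝ) + 1)⁻¹) * ∑ i : Fin n.succ,
        ENNReal.ofReal (bilinearConst d / ε) * (M i * M (n - i)) := by
  have hc : ‖-((n : ℂ) + 1)⁻¹‖ₑ = ENNReal.ofReal (((n : ℝ) + 1)⁻¹) := by
    rw [← ofReal_norm, norm_neg, norm_inv]
    congr 2
    exact_mod_cast Complex.norm_natCast (n + 1)
  rw [taylor_succ_fst, taylor_succ_snd, wiener_smul, wiener_smul, hc, ← mul_add]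
  refine mul_le_mul_right ?_ _
  refine (add_le_add (wiener_sum_le _ _ _) (wiener_sum_le _ _ _)).trans ?_
  rw [← Finset.sum_add_distrib]
  refine Finset.sum_le_sum fun i _ => ?_
  refine (add_le_add (wiener_sequenceNonlinearity_le hε hβ _ _)
    (wiener_sequenceNonlinearity_le hε hβ _ _)).trans ?_
  rw [← mul_add]
  refine mul_le_mul_right ?_ _
  refine le_trans ?_ (mul_le_mul' (hM i (Nat.lt_succ_iff.mp i.2)) (hM (n - i) (Nat.sub_le _ _)))
  rw [add_mul, mul_add, mul_add]
  -- Only cross terms between the two fields occur; the diagonal terms are added to complete the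
  -- product of the sums.
  calc _ ≤ _ := le_add_of_nonneg_right (zero_le (a :=
        wiener (β + ε) (taylor a₀ b₀ i).1 * wiener (β + ε) (taylor a₀ b₀ (n - i)).1 +
        wiener (β + ε) (taylor a₀ b₀ i).2 * wiener (β + ε) (taylor a₀ b₀ (n - i)).2))
    _ = _ := by ring

/-- Cauchy–Kovalevskaya estimate of the Taylor coefficients. -/
lemma wiener_taylor_le (a₀ b₀ : (Fin d → ℤ) → Vec d) {β₀ N : ℝ} (hN : 0 ≤ N)
    (h0 : wiener β₀ a₀ + wiener β₀ b₀ ≤ ENNReal.ofReal N) (n : ℕ) :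
    ∀ β, 0 ≤ β → β < β₀ → wiener β (taylor a₀ b₀ n).1 + wiener β (taylor a₀ b₀ n).2 ≤
      ENNReal.ofReal (catalan n * (4 * bilinearConst d) ^ n * N ^ (n + 1) / (β₀ - β) ^ n) := by
  have hB := bilinearConst_nonneg d
  induction n using Nat.strong_induction_on with
  | _ n ih =>
    intro β hβ hlt
    cases n with
    | zero =>
      rw [taylor_zero]
      simpa using (add_le_add (wiener_mono hlt.le a₀) (wiener_mono hlt.le b₀)).trans h0
    | succ n =>
      have hδ : 0 < β₀ - β := sub_pos.mpr hlt
      set δ := β₀ - β with hδdef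
      -- With this loss the remaining gap is `δ (n + 1) / (n + 2)`, so `1 / ((n + 1) ε η^n)` equals
      -- `((n + 2) / (n + 1))^{n+1} / δ^{n+1}`, and the numerator stays bounded.
      set ε := δ / (n + 2) with hεdef
      have hε : 0 < ε := by positivity
      have hγ : β₀ - (β + ε) = δ * ((n + 1) / (n + 2)) := by
        have : β₀ - (β + ε) = δ - ε := by rw [hδdef]; ring
        rw [this, hεdef]; field_simp; ring
      have hγ0 : 0 < β₀ - (β + ε) := by rw [hγ]; positivity
      set η := β₀ - (β + ε)
      refine (wiener_taylor_succ_le a₀ b₀ n hε (by positivity) (M := fun i =>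
        ENNReal.ofReal (catalan i * (4 * bilinearConst d) ^ i * N ^ (i + 1) / η ^ i))
        fun i hi => ih i (by omega) (β + ε) (by positivity) (by linarith)).trans ?_
      have hterm : ∀ i : Fin n.succ, ENNReal.ofReal (bilinearConst d / ε) *
          (ENNReal.ofReal (catalan i * (4 * bilinearConst d) ^ (i : ℕ) * N ^ ((i : ℕ) + 1)
            / η ^ (i : ℕ)) *
          ENNReal.ofReal (catalan (n - i) * (4 * bilinearConst d) ^ (n - i) * N ^ (n - i + 1)
            / η ^ (n - i))) =
          ENNReal.ofReal (bilinearConst d / ε * (4 * bilinearConst d) ^ n * N ^ (n + 2) / η ^ n *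
            (catalan i * catalan (n - i) : ℕ)) := by
        intro i
        rw [← ENNReal.ofReal_mul (by positivity), ← ENNReal.ofReal_mul (by positivity)]
        congr 1
        obtain ⟨j, hj⟩ := Nat.exists_eq_add_of_le (Nat.lt_succ_iff.mp i.2)
        have hj' : n - (i : ℕ) = j := by omega
        rw [hj']
        have e1 : ∀ x : ℝ, x ^ n = x ^ (i : ℕ) * x ^ j := fun x => by rw [← pow_add, ← hj]
        have e2 : N ^ (n + 2) = N ^ ((i : ℕ) + 1) * N ^ (j + 1) := by
          rw [← pow_add]; congr 1; omega
        rw [Nat.cast_mul, e1, e1 η, e2]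
        field_simp
      rw [Finset.sum_congr rfl fun i _ => hterm i,
        ← ENNReal.ofReal_sum_of_nonneg fun i _ => by positivity, ← Finset.mul_sum,
        ← Nat.cast_sum, ← catalan_succ, ← ENNReal.ofReal_mul (by positivity)]
      apply ENNReal.ofReal_le_ofReal
      -- This quantity is at most `e`; the bound `4` is the source of the `4` in `4 * bilinearConst
      -- d`.
      have hexp : (((n : ℝ) + 2) / (n + 1)) ^ (n + 1) ≤ 4 := by
        have h1 : ((n : ℝ) + 2) / (n + 1) ≤ Real.exp (1 / (n + 1)) := by
          refine le_trans (le_of_eq ?_) (Real.add_one_le_exp _)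
          field_simp; ring
        calc _ ≤ Real.exp (1 / ((n : ℝ) + 1)) ^ (n + 1) := by gcongr
          _ = Real.exp 1 := by
            rw [← Real.exp_nat_mul]; congr 1; push_cast; field_simp
          _ ≤ 4 := by linarith [Real.exp_one_lt_d9]
      calc _ = (catalan (n + 1) * (4 * bilinearConst d) ^ n * N ^ (n + 2) / δ ^ (n + 1)) *
            bilinearConst d * (((n : ℝ) + 2) / (n + 1)) ^ (n + 1) := by
            have hq : (((n : ℝ) + 2) / (n + 1)) ^ (n + 1)
                = ((((n : ℝ) + 1) / (n + 2)) ^ n)⁻¹ * (((n : ℝ) + 2) / (n + 1)) := by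
              rw [pow_succ, ← inv_pow, inv_div]
            have hQ : 0 < (((n : ℝ) + 1) / (n + 2)) ^ n := by positivity
            rw [hγ, hεdef, hq, mul_pow δ, pow_succ δ]
            generalize (((n : ℝ) + 1) / (n + 2)) ^ n = Q at hQ
            generalize (4 * bilinearConst d) ^ n = X
            field_simp
        _ ≤ (catalan (n + 1) * (4 * bilinearConst d) ^ n * N ^ (n + 2) / δ ^ (n + 1)) *
            bilinearConst d * 4 := by gcongr
        _ = _ := by rw [pow_succ (4 * bilinearConst d)]; ring

lemma catalan_le_four_pow (n : ℕ) : catalan n ≤ 4 ^ n := by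
  rw [catalan_eq_centralBinom_div]
  exact (Nat.div_le_self _ _).trans (Nat.centralBinom_le_four_pow n)

/-- Geometric bound of the Taylor coefficients in the Wiener norm of weight `β₀ / 2`. -/
lemma wiener_taylor_le_geometric (a₀ b₀ : (Fin d → ℤ) → Vec d) {β₀ N : ℝ} (hβ₀ : 0 < β₀)
    (hN : 0 ≤ N) (h0 : wiener β₀ a₀ + wiener β₀ b₀ ≤ ENNReal.ofReal N) (n : ℕ) :
    wiener (β₀ / 2) (taylor a₀ b₀ n).1 + wiener (β₀ / 2) (taylor a₀ b₀ n).2 ≤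
      ENNReal.ofReal (N * (32 * bilinearConst d * N / β₀) ^ n) := by
  have hB := bilinearConst_nonneg d
  refine (wiener_taylor_le a₀ b₀ hN h0 n (β₀ / 2) (by positivity) (by linarith)).trans
    (ENNReal.ofReal_le_ofReal ?_)
  have hc : (catalan n : ℝ) ≤ 4 ^ n := by exact_mod_cast catalan_le_four_pow n
  rw [sub_half]
  calc _ ≤ 4 ^ n * (4 * bilinearConst d) ^ n * N ^ (n + 1) / (β₀ / 2) ^ n := by gcongr
    _ = _ := by
      -- The `32` is `4` from the Catalan numbers, `4` from the recursion and `2` from the gap `β₀ /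
      -- 2`.
      have h : 32 * bilinearConst d * N / β₀ = 4 * (4 * bilinearConst d) * N / (β₀ / 2) := by
        field_simp; ring
      rw [h, div_pow (4 * (4 * bilinearConst d) * N), mul_pow _ N, mul_pow 4 (4 * bilinearConst d), pow_succ]
      ring

end Sequences

/-! ### Continuous functions with prescribed summable coefficients -/

section Synthesis

variable {d : ℕ} {F : Type*} [NormedAddCommGroup F] [NormedSpace ℂ F]

/-- The mode `x ↦ e^{i k·x} y` as a continuous function. -/
def modeMap (k : Fin d → ℤ) (y : F) : C(Torus d, F) where
  toFun x := character k x • y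
  continuous_toFun := (continuous_character k).smul continuous_const

@[simp] lemma modeMap_apply (k : Fin d → ℤ) (y : F) (x : Torus d) :
    modeMap k y x = character k x • y := rfl

lemma norm_modeMap_le (k : Fin d → ℤ) (y : F) : ‖modeMap k y‖ ≤ ‖y‖ :=
  (ContinuousMap.norm_le _ (norm_nonneg _)).mpr fun x => by simp [norm_smul]

/-- The continuous function with the given absolutely summable Fourier coefficients. -/
def synthesis (c : (Fin d → ℤ) → F) : C(Torus d, F) := ∑' k, modeMap k (c k)

lemma hasSum_synthesis [CompleteSpace F] {c : (Fin d → ℤ) → F} (hc : Summable fun k => ‖c k‖) :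
    HasSum (fun k => modeMap k (c k)) (synthesis c) :=
  (Summable.of_norm_bounded hc fun k => norm_modeMap_le k (c k)).hasSum

lemma norm_synthesis_le {c : (Fin d → ℤ) → F} (hc : Summable fun k => ‖c k‖) :
    ‖synthesis c‖ ≤ ∑' k, ‖c k‖ :=
  tsum_of_norm_bounded hc.hasSum fun k => norm_modeMap_le k (c k)

lemma fourierCoefficient_mode [CompleteSpace F] (m k : Fin d → ℤ) (y : F) :
    fourierCoefficient (modeMap m y) k = if m = k then y else 0 := by
  have h : fourierCoefficient (modeMap m y) k = fourierCoefficient (character m) k • y := by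
    unfold fourierCoefficient
    simp only [modeMap_apply, smul_smul, smul_eq_mul]
    rw [integral_smul_const, smul_smul]
  rw [h, fourierCoefficient_character]
  split_ifs <;> simp

lemma fourierCoefficient_synthesis [CompleteSpace F] {c : (Fin d → ℤ) → F} (hc : Summable fun k => ‖c k‖)
    (k : Fin d → ℤ) : fourierCoefficient (synthesis c) k = c k := by
  classical
  have hpt : ∀ x, ∑' m, character (-k) x • modeMap m (c m) x
      = character (-k) x • synthesis c x := fun x => by
    have h1 : HasSum (fun m => modeMap m (c m) x) (synthesis c x) :=
      (hasSum_synthesis hc).mapL (ContinuousMap.evalCLM ℂ x)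
    exact (h1.const_smul _).tsum_eq
  have hnorm : ∀ m, ∫ x, ‖character (-k) x • modeMap m (c m) x‖
      = (volume : Measure (Torus d)).real Set.univ * ‖c m‖ := fun m => by
    simp only [modeMap_apply, norm_smul, norm_character, one_mul]
    rw [integral_const, smul_eq_mul]
  have h2 := hasSum_integral_of_summable_integral_norm (μ := (volume : Measure (Torus d)))
    (F := fun m x => character (-k) x • modeMap m (c m) x)
    (fun m => ((continuous_character (-k)).smul (modeMap m (c m)).continuous).integrable_of_hasCompactSupport
      (HasCompactSupport.of_compactSpace _))
    (by simp only [hnorm]; exact hc.mul_left _)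
  simp only [hpt] at h2
  have h3 := h2.const_smul ((((2 * Real.pi : ℝ) : ℂ) ^ d)⁻¹)
  have h4 : HasSum (fun m => if m = k then c m else 0) (fourierCoefficient (synthesis c) k) :=
    h3.congr_fun fun m => (fourierCoefficient_mode m k (c m)).symm
  exact h4.unique ((hasSum_ite_eq k (c k)).congr_fun fun m => by
    split_ifs with h
    · rw [h]
    · rfl)

end Synthesis

/-! ### Summability over the frequency lattice -/

section LatticeSum

variable {d : ℕ}

/-- The frequencies form a lattice of rank `d`, and `d + 1 > d`. The exponent is fixed, rather than
tied to `r`, so that the resulting constant depends only on `d`. -/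
lemma summable_freqNorm_rpow (d : ℕ) :
    Summable fun k : Fin d → ℤ => freqNorm k ^ (-((d : ℝ) + 1)) := by
  set b := (EuclideanSpace.basisFun (Fin d) ℝ).toBasis with hb
  set L := Submodule.span ℤ (Set.range b) with hL
  have hmem : ∀ k : Fin d → ℤ,
      (WithLp.toLp 2 fun j => (k j : ℝ) : EuclideanSpace ℝ (Fin d)) ∈ L := by
    intro k
    have : (WithLp.toLp 2 fun j => (k j : ℝ) : EuclideanSpace ℝ (Fin d)) = ∑ j, k j • b j := by
      ext i
      simp [hb, Finset.sum_apply, Pi.single_apply]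
    rw [this]
    exact Submodule.sum_mem _ fun j _ =>
      Submodule.smul_mem _ _ (Submodule.subset_span ⟨j, rfl⟩)
  have hr : (-((d : ℝ) + 1)) < -(Module.finrank ℤ L : ℝ) := by
    rw [ZLattice.rank ℝ L, finrank_euclideanSpace_fin]
    linarith
  have h := (ZLattice.summable_norm_rpow L _ hr).comp_injective
    (i := fun k : Fin d → ℤ => (⟨_, hmem k⟩ : L)) (by
      intro k m hkm
      have := congrArg (fun z : L => (z : EuclideanSpace ℝ (Fin d))) hkm
      ext j
      have h2 := congrArg (fun z : EuclideanSpace ℝ (Fin d) => z j) this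
      simpa using h2)
  refine h.congr fun k => ?_
  rw [freqNorm_eq_norm]
  rfl

end LatticeSum

/-! ### Power series and Cauchy products in Banach spaces -/

section Series

/-- A power series with geometrically bounded coefficients can be differentiated termwise. -/
lemma hasDerivAt_tsum_pow_smul {E : Type*} [NormedAddCommGroup E] [NormedSpace ℂ E]
    [CompleteSpace E] {x : ℕ → E} {N q : ℝ} (hq : 0 ≤ q) (hx : ∀ n, ‖x n‖ ≤ N * q ^ n) {ζ : ℂ}
    (hζ : ‖ζ‖ * q < 1) :
    ∃ x' : E, HasSum (fun n : ℕ => ((n : ℂ) + 1) • ζ ^ n • x (n + 1)) x' ∧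
      HasDerivAt (fun z => ∑' n, z ^ n • x n) x' ζ := by
  -- A slightly larger disc still inside the disc of convergence; the denominator `q + 1` also
  -- covers `q = 0`.
  obtain ⟨ρ, hρ, hρq⟩ : ∃ ρ, ‖ζ‖ < ρ ∧ ρ * q < 1 := by
    refine ⟨‖ζ‖ + (1 - ‖ζ‖ * q) / (q + 1), by
      have : 0 < (1 - ‖ζ‖ * q) / (q + 1) := div_pos (by linarith) (by linarith)
      linarith, ?_⟩
    rw [add_mul, div_mul_eq_mul_div, ← lt_sub_iff_add_lt', div_lt_iff₀ (by linarith)]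
    nlinarith
  have hρ0 : 0 < ρ := (norm_nonneg ζ).trans_lt hρ
  have hmem : ζ ∈ Metric.ball (0 : ℂ) ρ := by simpa using hρ
  set u : ℕ → ℝ := fun n => N * ρ⁻¹ * ((n : ℝ) ^ 1 * (ρ * q) ^ n) with hu
  have hsum : Summable u := by
    have h : ‖ρ * q‖ < 1 := by rwa [Real.norm_of_nonneg (by positivity)]
    exact (summable_pow_mul_geometric_of_norm_lt_one 1 h).mul_left (N * ρ⁻¹)
  have hbound : ∀ (n : ℕ) (y : ℂ), y ∈ Metric.ball (0 : ℂ) ρ →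
      ‖((n : ℂ) * y ^ (n - 1)) • x n‖ ≤ u n := by
    intro n y hy
    have hy' : ‖y‖ ≤ ρ := (by simpa using hy : ‖y‖ < ρ).le
    rw [norm_smul, norm_mul, norm_pow, Complex.norm_natCast]
    calc _ ≤ (n : ℝ) * ρ ^ (n - 1) * (N * q ^ n) := by gcongr; exact hx n
      _ = u n := by
        rcases n with _ | n
        · simp [hu]
        · simp only [hu, Nat.add_sub_cancel, mul_pow, pow_one, pow_succ ρ]
          field_simp
  have hder := hasDerivAt_tsum_of_isPreconnected (g := fun n z => z ^ n • x n)
    (g' := fun n z => ((n : ℂ) * z ^ (n - 1)) • x n) hsum Metric.isOpen_ball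
    (convex_ball (0 : ℂ) ρ).isPreconnected
    (fun n y _ => (hasDerivAt_pow n y).smul_const (x n)) hbound
    (Metric.mem_ball_self hρ0)
    (summable_of_ne_finset_zero (s := {0}) fun n hn => by
      rw [zero_pow (by simpa using hn), zero_smul]) hmem
  refine ⟨_, ?_, hder⟩
  have h1 : Summable fun n : ℕ => ((n : ℂ) * ζ ^ (n - 1)) • x n :=
    Summable.of_norm_bounded hsum fun n => hbound n ζ hmem
  have h2 := (hasSum_nat_add_iff' 1).mpr h1.hasSum
  simp only [Finset.range_one, Finset.sum_singleton, Nat.cast_zero, zero_mul, zero_smul,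
    sub_zero] at h2
  refine h2.congr_fun fun n => ?_
  rw [smul_smul]
  simp

lemma summable_norm_pow_smul {E : Type*} [NormedAddCommGroup E] [NormedSpace ℂ E]
    {x : ℕ → E} {N q : ℝ} (hq : 0 ≤ q) (hx : ∀ n, ‖x n‖ ≤ N * q ^ n) {ζ : ℂ}
    (hζ : ‖ζ‖ * q < 1) : Summable fun n => ‖ζ ^ n • x n‖ := by
  refine Summable.of_nonneg_of_le (fun _ => norm_nonneg _) (fun n => ?_)
    ((summable_geometric_of_lt_one (by positivity) hζ).mul_left N)
  rw [norm_smul, norm_pow, mul_pow]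
  calc _ ≤ ‖ζ‖ ^ n * (N * q ^ n) := by gcongr; exact hx n
    _ = _ := by ring

/-- Cauchy product of two series under a bounded bilinear map. -/
lemma hasSum_cauchyProduct {E F G : Type*} [NormedAddCommGroup E] [NormedSpace ℂ E]
    [NormedAddCommGroup F] [NormedSpace ℂ F] [NormedAddCommGroup G] [NormedSpace ℂ G]
    [CompleteSpace E] [CompleteSpace F] [CompleteSpace G] (B : E →L[ℂ] F →L[ℂ] G) {f : ℕ → E} {g : ℕ → F}
    (hf : Summable fun n => ‖f n‖) (hg : Summable fun n => ‖g n‖) :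
    HasSum (fun n => ∑ i : Fin (n + 1), B (f i) (g (n - i))) (B (∑' n, f n) (∑' n, g n)) := by
  have hs : Summable fun p : ℕ × ℕ => B (f p.1) (g p.2) := by
    refine Summable.of_norm_bounded ((hf.mul_of_nonneg hg (fun _ => norm_nonneg _)
      (fun _ => norm_nonneg _)).mul_left ‖B‖) fun p => ?_
    rw [← mul_assoc]
    exact B.le_opNorm₂ _ _
  have hval : ∑' p : ℕ × ℕ, B (f p.1) (g p.2) = B (∑' n, f n) (∑' n, g n) := by
    rw [hs.tsum_prod]
    have h1 : ∀ i, ∑' j, B (f i) (g j) = B (f i) (∑' n, g n) := fun i =>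
      ((B (f i)).map_tsum hg.of_norm).symm
    simp only [h1]
    exact ((B.flip (∑' n, g n)).map_tsum hf.of_norm).symm
  have h2 := (Finset.HasAntidiagonal.sigmaAntidiagonalEquivProd.hasSum_iff.mpr hs.hasSum).sigma fun n =>
    hasSum_fintype _
  rw [hval] at h2
  refine h2.congr_fun fun n => ?_
  rw [Fin.sum_univ_eq_sum_range (fun i => B (f i) (g (n - i))) (n + 1),
    ← Finset.Nat.sum_antidiagonal_eq_sum_range_succ (fun i j => B (f i) (g j)) n,
    ← Finset.sum_coe_sort]
  rfl

end Series

/-! ### From decaying coefficients back to the differential equations -/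

section Regularity

variable {d : ℕ} {F : Type*} [NormedAddCommGroup F]

lemma summable_norm_of_wiener_ne_top {β : ℝ} (hβ : 0 ≤ β) {c : (Fin d → ℤ) → F}
    (h : wiener β c ≠ ∞) : Summable fun k => ‖c k‖ := by
  rw [← tsum_enorm_ne_top_iff_summable_norm]
  refine ne_top_of_le_ne_top h (ENNReal.tsum_le_tsum fun k => ?_)
  refine le_mul_of_one_le_left (zero_le (a := ‖c k‖ₑ)) ?_
  rw [← ENNReal.ofReal_one]
  exact ENNReal.ofReal_le_ofReal (Real.one_le_exp (mul_nonneg hβ (freqNorm_nonneg k)))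

lemma integrable_continuousMap (f : C(Torus d, F)) : Integrable f :=
  f.continuous.integrable_of_hasCompactSupport (HasCompactSupport.of_compactSpace _)

variable [NormedSpace ℂ F]

/-- A positive exponential weight pays for one derivative: `|k| ≤ e^{β|k|} / β`. -/
lemma wiener_partial_ne_top {β : ℝ} (hβ : 0 < β) {c : (Fin d → ℤ) → F} (h : wiener β c ≠ ∞)
    (j : Fin d) : wiener 0 (fun k : Fin d → ℤ => (Complex.I * (k j : ℂ)) • c k) ≠ ∞ := by
  refine ne_top_of_le_ne_top (ENNReal.mul_ne_top (ENNReal.ofReal_ne_top (r := 1 / β)) h) ?_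
  unfold wiener
  rw [← ENNReal.tsum_mul_left]
  refine ENNReal.tsum_le_tsum fun k => ?_
  rw [zero_mul, Real.exp_zero, ENNReal.ofReal_one, one_mul, enorm_smul, ← mul_assoc,
    ← ENNReal.ofReal_mul (by positivity)]
  refine mul_le_mul_left ?_ _
  rw [← ofReal_norm, norm_mul, Complex.norm_I, one_mul]
  refine ENNReal.ofReal_le_ofReal ((norm_freq_le k j).trans ?_)
  rw [div_mul_eq_mul_div, one_mul, le_div_iff₀ hβ, mul_comm]
  linarith [Real.add_one_le_exp (β * freqNorm k)]

variable [CompleteSpace F]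

lemma hasWeakPartial_synthesis {c : (Fin d → ℤ) → F} (hc : Summable fun k => ‖c k‖) (j : Fin d)
    (hc' : Summable fun k : Fin d → ℤ => ‖(Complex.I * (k j : ℂ)) • c k‖) :
    HasWeakPartial j (synthesis c)
      (synthesis fun k : Fin d → ℤ => (Complex.I * (k j : ℂ)) • c k) :=
  ⟨integrable_continuousMap _, integrable_continuousMap _, fun k => by
    rw [fourierCoefficient_synthesis hc, fourierCoefficient_synthesis hc']⟩

/-- The square integrable field with the given Fourier coefficients. -/
def synthesisL2 (c : (Fin d → ℤ) → Vec d) : L2 d :=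
  ContinuousMap.toLp (E := Vec d) 2 volume ℂ (synthesis c)

lemma coeFn_synthesisL2 (c : (Fin d → ℤ) → Vec d) :
    synthesisL2 c =ᵐ[volume] synthesis c :=
  ContinuousMap.coeFn_toLp volume (synthesis c)

lemma fourierCoefficient_synthesisL2 {c : (Fin d → ℤ) → Vec d} (hc : Summable fun k => ‖c k‖)
    (k : Fin d → ℤ) : fourierCoefficient (synthesisL2 c) k = c k := by
  rw [fourierCoefficient_congr (coeFn_synthesisL2 c), fourierCoefficient_synthesis hc]

lemma L2_ext {u v : L2 d} (h : ∀ k, fourierCoefficient u k = fourierCoefficient v k) : u = v := by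
  rw [← sub_eq_zero]
  refine L2_eq_zero_of_fourierCoefficient_eq_zero _ fun k => ?_
  rw [← coefficientL_apply, map_sub, coefficientL_apply, coefficientL_apply, h, sub_self]

lemma synthesisL2_fourierCoefficient {u : L2 d} (h : Summable fun k => ‖fourierCoefficient u k‖) :
    synthesisL2 (fourierCoefficient u) = u :=
  L2_ext (fourierCoefficient_synthesisL2 h)

lemma ae_norm_le_of_summable {u : L2 d} (h : Summable fun k => ‖fourierCoefficient u k‖) :
    ∀ᵐ x, ‖u x‖ ≤ ‖synthesis (fourierCoefficient u)‖ := by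
  have h1 := coeFn_synthesisL2 (fourierCoefficient u)
  rw [synthesisL2_fourierCoefficient h] at h1
  filter_upwards [h1] with x hx
  rw [hx]
  exact ContinuousMap.norm_coe_le_norm _ x

lemma exists_weakPartial {β : ℝ} (hβ : 0 < β) {u : L2 d}
    (h : wiener β (fourierCoefficient u) ≠ ∞) :
    ∃ Du : Fin d → L2 d, ∀ j, HasWeakPartial j u (Du j) :=
  ⟨fun j => synthesisL2 fun k => (Complex.I * (k j : ℂ)) • fourierCoefficient u k, fun j =>
    ⟨integrable_L2 u, integrable_L2 _, fun k => fourierCoefficient_synthesisL2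
      (summable_norm_of_wiener_ne_top le_rfl (wiener_partial_ne_top hβ h j)) k⟩⟩

lemma productCoefficient_eq_convolution (k : Fin d → ℤ) (i j : Fin d) (w v : L2 d) :
    productCoefficient k i j w v
      = convolution (fourierCoefficient w) (fourierCoefficient v) k i j :=
  (hasSum_productCoefficient k i j w v).tsum_eq.symm

lemma nonlinearity_eq_sequenceNonlinearity (k : Fin d → ℤ) (w v : L2 d) :
    nonlinearity k w v
      = sequenceNonlinearity (fourierCoefficient w) (fourierCoefficient v) k := by
  rw [nonlinearity, sequenceNonlinearity]
  congr 1
  ext i j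
  exact productCoefficient_eq_convolution k i j w v

/-- The pressure symbol has order zero and the Wiener space is an algebra, so the pressure keeps the
full weight `β`. -/
lemma wiener_pressure_ne_top {β : ℝ} (hβ : 0 ≤ β) {w v : L2 d}
    (hw : wiener β (fourierCoefficient w) ≠ ∞) (hv : wiener β (fourierCoefficient v) ≠ ∞) :
    wiener β (fun k => pressureSymbol k fun i j => productCoefficient k i j w v) ≠ ∞ := by
  refine ne_top_of_le_ne_top (ENNReal.mul_ne_top (a := (d : ℝ≥0∞) * d)
    (ENNReal.mul_ne_top (ENNReal.natCast_ne_top d) (ENNReal.natCast_ne_top d))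
    (ne_top_of_le_ne_top (ENNReal.mul_ne_top hw hv)
      (tsum_weight_mul_convolution_le hβ (fourierCoefficient w) (fourierCoefficient v)))) ?_
  rw [← ENNReal.tsum_mul_left]
  refine ENNReal.tsum_le_tsum fun k => ?_
  rw [mul_left_comm]
  refine mul_le_mul_right ?_ _
  have h1 := ENNReal.ofReal_le_ofReal
    (norm_pressureSymbol_le k fun i j => productCoefficient k i j w v)
  rw [ENNReal.ofReal_sum_of_nonneg fun i _ => Finset.sum_nonneg fun j _ => norm_nonneg _] at h1
  simp only [ENNReal.ofReal_sum_of_nonneg fun (j : Fin d) _ => norm_nonneg _, ofReal_norm] at h1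
  refine h1.trans ((Finset.sum_le_sum fun i _ => Finset.sum_le_sum fun j _ =>
    (congrArg (fun z : ℂ => ‖z‖ₑ) (productCoefficient_eq_convolution k i j w v)).le.trans
      (enorm_convolution_le _ _ k i j)).trans (le_of_eq ?_))
  simp only [Finset.sum_const, Finset.card_univ, Fintype.card_fin, nsmul_eq_mul]
  rw [mul_assoc]

/-- Fields with exponentially decaying Fourier coefficients that solve the ordinary differential
equations for the coefficients satisfy the two transport equations, with a common pressure. -/
lemma exists_pressure {β : ℝ} (hβ : 0 < β) {v w v' w' : L2 d} (mv : MemH v) (mw : MemH w)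
    (hv : wiener β (fourierCoefficient v) ≠ ∞) (hw : wiener β (fourierCoefficient w) ≠ ∞)
    (ev : ∀ k, fourierCoefficient v' k = -nonlinearity k w v)
    (ew : ∀ k, fourierCoefficient w' k = -nonlinearity k v w) :
    ∃ p : Torus d → ℂ, TransportEq v' w v p ∧ TransportEq w' v w p := by
  obtain ⟨Dv, hDv⟩ := exists_weakPartial hβ hv
  obtain ⟨Dw, hDw⟩ := exists_weakPartial hβ hw
  have hp := wiener_pressure_ne_top hβ.le hw hv
  have hps := summable_norm_of_wiener_ne_top hβ.le hp
  have hpd := fun j => summable_norm_of_wiener_ne_top le_rfl (wiener_partial_ne_top hβ hp j)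
  have hmem : ∀ f : C(Torus d, ℂ), MemLp f 2 (volume : Measure (Torus d)) := fun f =>
    MemLp.of_bound f.continuous.aestronglyMeasurable ‖f‖
      (Eventually.of_forall fun x => f.norm_coe_le_norm x)
  refine ⟨synthesis fun k => pressureSymbol k fun i j => productCoefficient k i j w v, ?_, ?_⟩
  · exact transportEq_of_fourierCoefficient mw
      (ae_norm_le_of_summable (summable_norm_of_wiener_ne_top hβ.le hw)) hDv
      (fun j => hasWeakPartial_synthesis hps j (hpd j)) (fun j => hmem _)
      (fun k => fourierCoefficient_synthesis hps k) ev
  · exact transportEq_of_fourierCoefficient mv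
      (ae_norm_le_of_summable (summable_norm_of_wiener_ne_top hβ.le hv)) hDw
      (fun j => hasWeakPartial_synthesis hps j (hpd j)) (fun j => hmem _)
      (fun k => (fourierCoefficient_synthesis hps k).trans (pressureSymbol_swap k w v)) ew

end Regularity

/-! ### The weighted `ℓ¹` space and its maps to `L²` and Gevrey spaces -/

section Weighted

variable {d : ℕ}

/-- The space of absolutely summable sequences of vectors. -/
abbrev WeightedSpace (d : ℕ) : Type := lp (fun _ : Fin d → ℤ => Vec d) 1

lemma hasSum_norm_weighted (x : WeightedSpace d) : HasSum (fun k => ‖x k‖) ‖x‖ := by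
  simpa using lp.hasSum_norm (by simp) x

/-- The weight `e^{β|k|}`, as a complex number. -/
def weight (β : ℝ) (k : Fin d → ℤ) : ℂ := (Real.exp (β * freqNorm k) : ℝ)

lemma weight_neg_mul (β : ℝ) (k : Fin d → ℤ) : weight (-β) k * weight β k = 1 := by
  unfold weight
  rw [← Complex.ofReal_mul, ← Real.exp_add]
  simp

lemma norm_weight (β : ℝ) (k : Fin d → ℤ) : ‖weight β k‖ = Real.exp (β * freqNorm k) := by
  rw [weight, Complex.norm_real, Real.norm_of_nonneg (Real.exp_pos _).le]

lemma norm_weight_neg_smul_le {β : ℝ} (hβ : 0 ≤ β) (k : Fin d → ℤ) (y : Vec d) :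
    ‖weight (-β) k • y‖ ≤ ‖y‖ := by
  rw [norm_smul, norm_weight]
  refine mul_le_of_le_one_left (norm_nonneg _) (Real.exp_le_one_iff.mpr ?_)
  have := mul_nonneg hβ (freqNorm_nonneg k)
  linarith

lemma summable_weighted {β : ℝ} (hβ : 0 ≤ β) (x : WeightedSpace d) :
    Summable fun k => ‖weight (-β) k • x k‖ :=
  (hasSum_norm_weighted x).summable.of_nonneg_of_le (fun _ => norm_nonneg _)
    fun k => norm_weight_neg_smul_le hβ k _

/-- The field with Fourier coefficients `e^{-β|k|} x(k)`. -/
def weightedField {β : ℝ} (hβ : 0 ≤ β) : WeightedSpace d →L[ℂ] L2 d :=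
  LinearMap.mkContinuous
    { toFun := fun x => synthesisL2 fun k => weight (-β) k • x k
      map_add' := fun x y => L2_ext fun k => by
        rw [← coefficientL_apply (u := _ + _), map_add, coefficientL_apply, coefficientL_apply,
          fourierCoefficient_synthesisL2 (summable_weighted hβ _),
          fourierCoefficient_synthesisL2 (summable_weighted hβ _),
          fourierCoefficient_synthesisL2 (summable_weighted hβ _), lp.coeFn_add, Pi.add_apply,
          smul_add]
      map_smul' := fun c x => L2_ext fun k => by
        rw [← coefficientL_apply (u := _ • _), map_smul, coefficientL_apply,
          fourierCoefficient_synthesisL2 (summable_weighted hβ _),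
          fourierCoefficient_synthesisL2 (summable_weighted hβ _), lp.coeFn_smul, Pi.smul_apply,
          smul_comm, RingHom.id_apply] }
    ‖(ContinuousMap.toLp (E := Vec d) 2 (volume : Measure (Torus d)) ℂ)‖
    fun x => by
      refine ((ContinuousMap.toLp (E := Vec d) 2 (volume : Measure (Torus d)) ℂ).le_opNorm
        (synthesis fun k => weight (-β) k • x k)).trans ?_
      refine mul_le_mul_of_nonneg_left ?_ (norm_nonneg _)
      refine (norm_synthesis_le (summable_weighted hβ x)).trans ?_
      rw [← (hasSum_norm_weighted x).tsum_eq]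
      exact (summable_weighted hβ x).tsum_le_tsum
        (fun k => norm_weight_neg_smul_le hβ k _) (hasSum_norm_weighted x).summable

lemma fourierCoefficient_weightedField {β : ℝ} (hβ : 0 ≤ β) (x : WeightedSpace d)
    (k : Fin d → ℤ) : fourierCoefficient (weightedField hβ x) k = weight (-β) k • x k :=
  fourierCoefficient_synthesisL2 (summable_weighted hβ x) k

lemma wiener_weightedField_ne_top {β : ℝ} (hβ : 0 ≤ β) (x : WeightedSpace d) :
    wiener β (fourierCoefficient (weightedField hβ x)) ≠ ∞ := by
  have h : wiener β (fourierCoefficient (weightedField hβ x)) = ∑' k, ‖x k‖ₑ := by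
    refine tsum_congr fun k => ?_
    rw [fourierCoefficient_weightedField, enorm_smul, ← ofReal_norm (weight (-β) k), norm_weight,
      ← mul_assoc, ← ENNReal.ofReal_mul (Real.exp_pos _).le, ← Real.exp_add]
    simp
  rw [h]
  exact tsum_enorm_ne_top_iff_summable_norm.mpr (hasSum_norm_weighted x).summable

/-- Multiplying by `e^{β|k|}` inverts `weightedField` on coefficients. Wiener bounds thereby become
norm bounds in a Banach space, where the time series can be summed. -/
lemma exists_weighted {β A : ℝ} (hA : 0 ≤ A) {c : (Fin d → ℤ) → Vec d}
    (h : wiener β c ≤ ENNReal.ofReal A) :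
    ∃ x : WeightedSpace d, ‖x‖ ≤ A ∧ ∀ k, weight (-β) k • x k = c k := by
  have he : ∀ k, ENNReal.ofReal (Real.exp (β * freqNorm k)) * ‖c k‖ₑ = ‖weight β k • c k‖ₑ := by
    intro k
    rw [enorm_smul, ← ofReal_norm (weight β k), norm_weight]
  unfold wiener at h
  simp only [he] at h
  have hs : Summable fun k => ‖weight β k • c k‖ :=
    tsum_enorm_ne_top_iff_summable_norm.mp (ne_top_of_le_ne_top ENNReal.ofReal_ne_top h)
  have hm : Memℓp (fun k => weight β k • c k) 1 := memℓp_gen (by simpa using hs)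
  refine ⟨⟨_, hm⟩, ?_, fun k => ?_⟩
  · rw [← (hasSum_norm_weighted _).tsum_eq, ← ENNReal.ofReal_le_ofReal_iff hA,
      ENNReal.ofReal_tsum_of_nonneg (fun _ => norm_nonneg _) hs]
    simpa only [ofReal_norm] using h
  · change weight (-β) k • weight β k • c k = c k
    rw [smul_smul, weight_neg_mul, one_smul]

/-- The inequality `τ ≤ e^τ` at `τ = δ t / s`, raised to the power `s`. -/
lemma rpow_le_mul_exp {s δ t : ℝ} (hs : 0 < s) (hδ : 0 < δ) (ht : 0 ≤ t) :
    t ^ s ≤ (s / δ) ^ s * Real.exp (δ * t) := by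
  have h : t ≤ s / δ * Real.exp (δ / s * t) := by
    have h1 := Real.add_one_le_exp (δ / s * t)
    calc t = s / δ * (δ / s * t) := by field_simp
      _ ≤ _ := by gcongr; linarith
  calc t ^ s ≤ (s / δ * Real.exp (δ / s * t)) ^ s := by gcongr
    _ = _ := by
      rw [Real.mul_rpow (by positivity) (Real.exp_pos _).le, ← Real.exp_mul]
      congr 2
      field_simp

/-- The Gevrey norm of smaller weight is bounded on the weighted space. -/
lemma exists_gevreyNorm_weightedField_le {r β : ℝ} (hr : 0 < r) (hβ : 0 < β) :
    ∃ K : ℝ, ∀ x : WeightedSpace d, GevreyFinite r (β / 2) (weightedField hβ.le x) ∧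
      gevreyNorm r (β / 2) (weightedField hβ.le x) ≤ K * ‖x‖ := by
  set A : ℝ := (2 * Real.pi) ^ d * (2 * r / β) ^ (2 * r) with hA
  have hA0 : 0 ≤ A := by positivity
  refine ⟨Real.sqrt A, fun x => ?_⟩
  have hterm : ∀ k, gevreyTerm r (β / 2) (weightedField hβ.le x) k ≤ A * ‖x‖ * ‖x k‖ := by
    intro k
    -- Halving the weight leaves a spare `e^{-β|k|}` in the squared norm, which absorbs `|k|^{2r}`.
    -- What remains is an `ℓ²` sum, dominated by the `ℓ¹` norm.
    have h1 := rpow_le_mul_exp (s := 2 * r) (by positivity) hβ (freqNorm_nonneg k)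
    unfold gevreyTerm
    rw [fourierCoefficient_weightedField, norm_smul, norm_weight]
    have hx : ‖x k‖ ≤ ‖x‖ := lp.norm_apply_le_norm one_ne_zero x k
    calc _ ≤ (2 * Real.pi) ^ d * ((2 * r / β) ^ (2 * r) * Real.exp (β * freqNorm k) *
          Real.exp (2 * (β / 2) * freqNorm k) *
          (Real.exp (-β * freqNorm k) * ‖x k‖) ^ 2) := by gcongr
      _ = A * (Real.exp (β * freqNorm k) * Real.exp (2 * (β / 2) * freqNorm k) *
          (Real.exp (-β * freqNorm k) * Real.exp (-β * freqNorm k))) * (‖x k‖ * ‖x k‖) := by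
          rw [hA]; ring
      _ = A * (‖x k‖ * ‖x k‖) := by
          rw [← Real.exp_add, ← Real.exp_add, ← Real.exp_add]
          ring_nf
          simp
      _ ≤ A * (‖x‖ * ‖x k‖) := by gcongr
      _ = _ := by ring
  have hnn : ∀ k, 0 ≤ gevreyTerm r (β / 2) (weightedField hβ.le x) k := fun k => by
    have := freqNorm_nonneg k
    unfold gevreyTerm; positivity
  have hs := (hasSum_norm_weighted x).mul_left (A * ‖x‖)
  have hfin : GevreyFinite r (β / 2) (weightedField hβ.le x) :=
    hs.summable.of_nonneg_of_le hnn hterm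
  refine ⟨hfin, ?_⟩
  have h2 := hfin.tsum_le_tsum hterm hs.summable
  rw [hs.tsum_eq] at h2
  unfold gevreyNorm
  calc _ ≤ Real.sqrt (A * ‖x‖ * ‖x‖) := Real.sqrt_le_sqrt h2
    _ = _ := by
      rw [mul_assoc, Real.sqrt_mul hA0, Real.sqrt_mul_self (norm_nonneg _)]

/-- A differentiable curve in the weighted space is differentiable in a Gevrey norm. -/
lemma gevreyDifferentiableAt_weightedField {r β : ℝ} (hr : 0 < r) (hβ : 0 < β)
    {X : ℂ → WeightedSpace d} {x' : WeightedSpace d} {ζ : ℂ} (h : HasDerivAt X x' ζ) :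
    GevreyDifferentiableAt r (fun z => weightedField hβ.le (X z)) ζ := by
  obtain ⟨K, hK⟩ := exists_gevreyNorm_weightedField_le (d := d) hr hβ
  refine ⟨β / 2, half_pos hβ, Eventually.of_forall fun z => (hK _).1,
    weightedField hβ.le x', (hK _).1, ?_⟩
  have h1 : Tendsto (fun z => K * ‖(z - ζ)⁻¹ • (X z - X ζ) - x'‖) (𝓝[≠] ζ) (𝓝 0) := by
    have h2 := ((hasDerivAt_iff_tendsto_slope.mp h).sub_const x').norm.const_mul K
    simpa [slope_def_module] using h2
  refine squeeze_zero (fun z => Real.sqrt_nonneg _) (fun z => ?_) h1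
  rw [← map_sub, ← map_smul, ← map_sub]
  exact (hK _).2

end Weighted

/-! ### Bounding the Wiener norm of the data by the Gevrey norm -/

section InitialData

variable {d : ℕ}

lemma one_le_freqNorm {k : Fin d → ℤ} (hk : k ≠ 0) : 1 ≤ freqNorm k := by
  obtain ⟨j, hj⟩ := Function.ne_iff.mp hk
  refine le_trans ?_ (norm_freq_le k j)
  rw [Complex.norm_intCast]
  exact_mod_cast Int.one_le_abs hj

lemma gevreyTerm_nonneg (r β : ℝ) (u : L2 d) (k : Fin d → ℤ) : 0 ≤ gevreyTerm r β u k := by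
  have := freqNorm_nonneg k
  unfold gevreyTerm
  positivity

/-- The Gevrey norm controls the Wiener norm of the same exponential weight. -/
lemma wiener_le_gevreyNorm {r β : ℝ} (hr : ((d : ℝ) + 1) / 2 < r) {u : L2 d}
    (h0 : fourierCoefficient u 0 = 0) (hu : GevreyFinite r β u) :
    wiener β (fourierCoefficient u) ≤ ENNReal.ofReal
      (Real.sqrt (∑' k : Fin d → ℤ, freqNorm k ^ (-((d : ℝ) + 1))) * gevreyNorm r β u) := by
  set f : (Fin d → ℤ) → ℝ := fun k => Real.sqrt (freqNorm k ^ (-((d : ℝ) + 1))) with hf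
  set g : (Fin d → ℤ) → ℝ := fun k => Real.sqrt (gevreyTerm r β u k) with hg
  have hf2 : ∀ k, f k ^ (2 : ℝ) = freqNorm k ^ (-((d : ℝ) + 1)) := fun k => by
    rw [Real.rpow_two, Real.sq_sqrt (Real.rpow_nonneg (freqNorm_nonneg k) _)]
  have hg2 : ∀ k, g k ^ (2 : ℝ) = gevreyTerm r β u k := fun k => by
    rw [Real.rpow_two, Real.sq_sqrt (gevreyTerm_nonneg r β u k)]
  have hpq : (2 : ℝ).HolderConjugate 2 := Real.HolderConjugate.two_two
  -- Cauchy–Schwarz, with `|k|^{-(d+1)/2}` split off from the Gevrey weight.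
  have hCS := Real.summable_and_inner_le_Lp_mul_Lq_tsum_of_nonneg hpq
    (f := f) (g := g) (fun k => Real.sqrt_nonneg _) (fun k => Real.sqrt_nonneg _)
    ((summable_freqNorm_rpow d).congr fun k => (hf2 k).symm) (hu.congr fun k => (hg2 k).symm)
  have hle : ∀ k, Real.exp (β * freqNorm k) * ‖fourierCoefficient u k‖ ≤ f k * g k := by
    intro k
    rcases eq_or_ne k 0 with rfl | hk
    · rw [h0, norm_zero, mul_zero]
      exact mul_nonneg (Real.sqrt_nonneg _) (Real.sqrt_nonneg _)
    have h1 := one_le_freqNorm hk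
    have ht : 0 < freqNorm k := by linarith
    rw [hf, hg]
    dsimp only
    rw [← Real.sqrt_mul (Real.rpow_nonneg ht.le _)]
    apply Real.le_sqrt_of_sq_le
    unfold gevreyTerm
    have h2 : 1 ≤ freqNorm k ^ (-((d : ℝ) + 1)) * freqNorm k ^ (2 * r) := by
      -- Here `2r > d + 1` and `|k| ≥ 1` enter; the mode `k = 0` was excluded by the zero mean.
      rw [← Real.rpow_add ht]
      exact Real.one_le_rpow h1 (by linarith)
    have h3 : (1 : ℝ) ≤ (2 * Real.pi) ^ d :=
      one_le_pow₀ (by linarith [Real.pi_gt_three])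
    have h4 : Real.exp (2 * β * freqNorm k) = Real.exp (β * freqNorm k) ^ 2 := by
      rw [← Real.exp_nat_mul]; congr 1; push_cast; ring
    rw [h4, mul_pow]
    set E := Real.exp (β * freqNorm k) ^ 2 * ‖fourierCoefficient u k‖ ^ 2 with hE
    have hE0 : 0 ≤ E := by positivity
    calc E = 1 * 1 * E := by ring
      _ ≤ (2 * Real.pi) ^ d * (freqNorm k ^ (-((d : ℝ) + 1)) * freqNorm k ^ (2 * r)) * E := by
        gcongr
      _ = _ := by rw [hE]; ring
  have hle' : wiener β (fourierCoefficient u) ≤ ENNReal.ofReal (∑' k, f k * g k) := by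
    rw [ENNReal.ofReal_tsum_of_nonneg
      (fun k => mul_nonneg (Real.sqrt_nonneg _) (Real.sqrt_nonneg _)) hCS.1]
    refine ENNReal.tsum_le_tsum fun k => ?_
    rw [← ofReal_norm, ← ENNReal.ofReal_mul (Real.exp_pos _).le]
    exact ENNReal.ofReal_le_ofReal (hle k)
  refine hle'.trans (ENNReal.ofReal_le_ofReal (hCS.2.trans (le_of_eq ?_)))
  simp only [hf2, hg2]
  rw [← Real.sqrt_eq_rpow, ← Real.sqrt_eq_rpow]
  rfl

end InitialData

/-! ### Existence by summing the Taylor series in complex time -/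

section Existence

variable {d : ℕ}

/-- The symbol is linear in the matrix of product coefficients, so the Cauchy product may be taken
entry by entry. -/
lemma hasSum_nonlinearity (k : Fin d → ℤ) {f g : ℕ → L2 d} (hf : Summable fun n => ‖f n‖)
    (hg : Summable fun n => ‖g n‖) :
    HasSum (fun n => ∑ i : Fin (n + 1), nonlinearity k (f i) (g (n - i)))
      (nonlinearity k (∑' n, f n) (∑' n, g n)) := by
  have h : HasSum (fun n => (∑ l : Fin (n + 1), fun i j =>
      productCoefficient k i j (f l) (g (n - l)) : Fin d → Fin d → ℂ))
      (fun i j => productCoefficient k i j (∑' n, f n) (∑' n, g n)) := by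
    rw [Pi.hasSum]
    intro i
    rw [Pi.hasSum]
    intro j
    simpa only [Finset.sum_apply] using hasSum_cauchyProduct (productCoefficient k i j) hf hg
  have h2 := h.mapL (LinearMap.toContinuousLinearMap (eulerSymbolLinear k))
  simp only [map_sum] at h2
  convert! h2 using 1
  · funext n
    refine Finset.sum_congr rfl fun i _ => ?_
    rw [nonlinearity]; rfl
  · rw [nonlinearity]; rfl

/-- A power series in time whose coefficients satisfy the Taylor recursion solves the ordinary
differential equations for the Fourier coefficients. -/
lemma fourierCoefficient_derivative {f g : ℕ → L2 d} {v' : L2 d} {z : ℂ}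
    (hfg : ∀ (n : ℕ) (k : Fin d → ℤ), ((n : ℂ) + 1) • fourierCoefficient (f (n + 1)) k =
      -∑ i : Fin (n + 1), nonlinearity k (g i) (f (n - i)))
    (hf : Summable fun n => ‖z ^ n • f n‖) (hg : Summable fun n => ‖z ^ n • g n‖)
    (hv' : HasSum (fun n : ℕ => ((n : ℂ) + 1) • z ^ n • f (n + 1)) v') (k : Fin d → ℤ) :
    fourierCoefficient v' k = -nonlinearity k (∑' n, z ^ n • g n) (∑' n, z ^ n • f n) := by
  have h1 := hv'.mapL (coefficientL k)
  have h2 := (hasSum_nonlinearity k hg hf).neg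
  rw [← coefficientL_apply]
  refine h1.unique (h2.congr_fun fun n => ?_)
  rw [map_smul, map_smul, smul_comm, coefficientL_apply, hfg, smul_neg, Finset.smul_sum]
  congr 1
  refine Finset.sum_congr rfl fun i _ => ?_
  rw [nonlinearity_smul_left, nonlinearity_smul_right, smul_smul, ← pow_add,
    Nat.add_sub_cancel' (Nat.lt_succ_iff.mp i.2)]

/-- The conditions defining `H_ℂ` are the vanishing of bounded linear maps, hence pass to sums of
series. -/
lemma memH_of_hasSum {ι : Type*} {f : ι → L2 d} {u : L2 d} (h : HasSum f u)
    (hf : ∀ n, MemH (f n)) : MemH u := by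
  constructor
  · have h1 := h.mapL (coefficientL 0)
    rw [← coefficientL_apply]
    refine h1.unique (hasSum_zero.congr_fun fun n => ?_)
    rw [coefficientL_apply, (hf n).1]
  · intro k
    have h1 := h.mapL ((∑ j, (k j : ℂ) • (EuclideanSpace.proj j : Vec d →L[ℂ] ℂ)).comp
      (coefficientL k))
    have h2 : ∀ u : L2 d, ((∑ j, (k j : ℂ) • (EuclideanSpace.proj j : Vec d →L[ℂ] ℂ)).comp
        (coefficientL k)) u = ∑ j, (k j : ℂ) * fourierCoefficient u k j := fun u => by
      simp [coefficientL_apply]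
    rw [← h2]
    refine h1.unique (hasSum_zero.congr_fun fun n => ?_)
    rw [h2, (hf n).2 k]

lemma memH_smul {u : L2 d} (c : ℂ) (hu : MemH u) : MemH (c • u) := by
  have h : ∀ k, fourierCoefficient (c • u : L2 d) k = c • fourierCoefficient u k := fun k => by
    rw [← coefficientL_apply, map_smul, coefficientL_apply]
  refine ⟨by rw [h, hu.1, smul_zero], fun k => ?_⟩
  simp only [h, PiLp.smul_apply, smul_eq_mul, mul_left_comm _ c, ← Finset.mul_sum, hu.2 k,
    mul_zero]

/-- The Taylor recursion preserves `H_ℂ`. -/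
lemma memH_of_recursion {f g : ℕ → L2 d} (h0 : MemH (f 0))
    (hfg : ∀ (n : ℕ) (k : Fin d → ℤ), ((n : ℂ) + 1) • fourierCoefficient (f (n + 1)) k =
      -∑ i : Fin (n + 1), nonlinearity k (g i) (f (n - i))) (n : ℕ) : MemH (f n) := by
  cases n with
  | zero => exact h0
  | succ n =>
    have hn : ((n : ℂ) + 1) ≠ 0 := by exact_mod_cast Nat.succ_ne_zero n
    constructor
    · have h := hfg n 0
      simp only [nonlinearity, eulerSymbol_zero_left, Finset.sum_const_zero, neg_zero] at h
      exact (smul_eq_zero.mp h).resolve_left hn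
    · intro k
      have h : ((n : ℂ) + 1) * ∑ j, (k j : ℂ) * fourierCoefficient (f (n + 1)) k j = 0 := by
        calc _ = ∑ j, (k j : ℂ) * (((n : ℂ) + 1) • fourierCoefficient (f (n + 1)) k) j := by
              simp only [PiLp.smul_apply, smul_eq_mul, Finset.mul_sum, mul_left_comm]
          _ = -∑ i : Fin (n + 1), ∑ j, (k j : ℂ) * nonlinearity k (g i) (f (n - i)) j := by
              rw [hfg, Finset.sum_comm]
              simp only [PiLp.neg_apply, WithLp.ofLp_sum, Finset.sum_apply, mul_neg, Finset.sum_neg_distrib,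
                Finset.mul_sum]
          _ = 0 := by
              simp only [nonlinearity, sum_freq_mul_eulerSymbol, Finset.sum_const_zero, neg_zero]
      exact (mul_eq_zero.mp h).resolve_left hn

/-- Existence of a solution by power series in complex time. -/
theorem exists_isSolution {β₀ N : ℝ} (hβ₀ : 0 < β₀) (hN : 0 ≤ N) {v₀ w₀ : L2 d} (hv₀ : MemH v₀)
    (hw₀ : MemH w₀)
    (h0 : wiener β₀ (fourierCoefficient v₀) + wiener β₀ (fourierCoefficient w₀)
      ≤ ENNReal.ofReal N) {R : Set ℂ}
    (hR : ∀ ζ ∈ R, ‖ζ‖ * (32 * bilinearConst d * N / β₀) < 1) :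
    ∃ v w : ℂ → L2 d, IsSolution R v₀ w₀ v w ∧ ∀ r : ℝ, 0 < r → ∀ ζ ∈ R,
      GevreyDifferentiableAt r v ζ ∧ GevreyDifferentiableAt r w ζ := by
  have hB := bilinearConst_nonneg d
  set q : ℝ := 32 * bilinearConst d * N / β₀ with hqdef
  have hq : 0 ≤ q := by positivity
  have hβ : 0 < β₀ / 2 := half_pos hβ₀
  set a := fun n => (taylor (fourierCoefficient v₀) (fourierCoefficient w₀) n).1 with ha
  set b := fun n => (taylor (fourierCoefficient v₀) (fourierCoefficient w₀) n).2 with hb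
  have hbound := wiener_taylor_le_geometric (fourierCoefficient v₀) (fourierCoefficient w₀)
    hβ₀ hN h0
  have hx : ∀ n, ∃ x : WeightedSpace d, ‖x‖ ≤ N * q ^ n ∧
      ∀ k, weight (-(β₀ / 2)) k • x k = a n k := fun n =>
    exists_weighted (by positivity) (le_self_add.trans (hbound n))
  have hy : ∀ n, ∃ y : WeightedSpace d, ‖y‖ ≤ N * q ^ n ∧
      ∀ k, weight (-(β₀ / 2)) k • y k = b n k := fun n =>
    exists_weighted (by positivity) (le_add_self.trans (hbound n))
  choose x hxn hxa using hx
  choose y hyn hyb using hy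
  set T := weightedField (d := d) hβ.le with hT
  have cx : ∀ n, fourierCoefficient (T (x n)) = a n := fun n => funext fun k => by
    rw [hT, fourierCoefficient_weightedField, hxa]
  have cy : ∀ n, fourierCoefficient (T (y n)) = b n := fun n => funext fun k => by
    rw [hT, fourierCoefficient_weightedField, hyb]
  have x0 : T (x 0) = v₀ := L2_ext fun k => by rw [cx, ha]; simp only [taylor_zero]
  have y0 : T (y 0) = w₀ := L2_ext fun k => by rw [cy, hb]; simp only [taylor_zero]
  have hcancel : ∀ (n : ℕ) (s : Vec d), ((n : ℂ) + 1) • (-((n : ℂ) + 1)⁻¹ • s) = -s := by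
    intro n s
    have hn : ((n : ℂ) + 1) ≠ 0 := by exact_mod_cast Nat.succ_ne_zero n
    rw [smul_smul, mul_neg, mul_inv_cancel₀ hn, neg_one_smul]
  have rx : ∀ (n : ℕ) (k : Fin d → ℤ), ((n : ℂ) + 1) • fourierCoefficient (T (x (n + 1))) k =
      -∑ i : Fin (n + 1), nonlinearity k (T (y i)) (T (x (n - i))) := by
    intro n k
    simp only [nonlinearity_eq_sequenceNonlinearity, cx, cy, ha, hb]
    rw [taylor_succ_fst, Pi.smul_apply, Finset.sum_apply, hcancel]
  have ry : ∀ (n : ℕ) (k : Fin d → ℤ), ((n : ℂ) + 1) • fourierCoefficient (T (y (n + 1))) k =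
      -∑ i : Fin (n + 1), nonlinearity k (T (x i)) (T (y (n - i))) := by
    intro n k
    simp only [nonlinearity_eq_sequenceNonlinearity, cx, cy, ha, hb]
    rw [taylor_succ_snd, Pi.smul_apply, Finset.sum_apply, hcancel]
  have mx := memH_of_recursion (f := fun n => T (x n)) (g := fun n => T (y n))
    (by rw [x0]; exact hv₀) rx
  have my := memH_of_recursion (f := fun n => T (y n)) (g := fun n => T (x n))
    (by rw [y0]; exact hw₀) ry
  -- The sums are formed in the weighted space; applying `T` transfers their derivatives to `L²` and
  -- to the Gevrey norms.
  set X : ℂ → WeightedSpace d := fun z => ∑' n, z ^ n • x n with hX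
  set Y : ℂ → WeightedSpace d := fun z => ∑' n, z ^ n • y n with hY
  have seriesT : ∀ (u : ℕ → WeightedSpace d) (z : ℂ), (∀ n, ‖u n‖ ≤ N * q ^ n) → ‖z‖ * q < 1 →
      (Summable fun n => ‖z ^ n • T (u n)‖) ∧
      HasSum (fun n => z ^ n • T (u n)) (T (∑' n, z ^ n • u n)) := by
    intro u z hu hz
    have h1 := summable_norm_pow_smul hq hu hz
    constructor
    · refine Summable.of_nonneg_of_le (fun _ => norm_nonneg _) (fun n => ?_) (h1.mul_left ‖T‖)
      rw [← map_smul]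
      exact T.le_opNorm _
    · simpa only [map_smul] using h1.of_norm.hasSum.mapL T
  have memT : ∀ (u : ℕ → WeightedSpace d) (z : ℂ), (∀ n, ‖u n‖ ≤ N * q ^ n) → ‖z‖ * q < 1 →
      (∀ n, MemH (T (u n))) → MemH (T (∑' n, z ^ n • u n)) := fun u z hu hz hm =>
    memH_of_hasSum (seriesT u z hu hz).2 fun n => memH_smul _ (hm n)
  -- The series is differentiable at the centre, hence continuous there, with its constant
  -- coefficient as value.
  have hinit : ∀ (u : ℕ → WeightedSpace d), (∀ n, ‖u n‖ ≤ N * q ^ n) →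
      Tendsto (fun z => T (∑' n, z ^ n • u n)) (𝓝[R] 0) (𝓝 (T (u 0))) := by
    intro u hu
    obtain ⟨u', -, hd⟩ := hasDerivAt_tsum_pow_smul hq hu (ζ := 0) (by simp)
    have h1 := (T.continuous.continuousAt.comp hd.continuousAt).tendsto
    have h2 : (∑' n, (0 : ℂ) ^ n • u n) = u 0 := by
      rw [tsum_eq_single 0 fun n hn => by rw [zero_pow hn, zero_smul], pow_zero, one_smul]
    simp only [Function.comp_def, h2] at h1
    exact h1.mono_left nhdsWithin_le_nhds
  refine ⟨fun z => T (X z), fun z => T (Y z), ⟨?_, ?_, ?_, ?_, ?_⟩, ?_⟩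
  · exact fun ζ hζ => memT x ζ hxn (hR ζ hζ) mx
  · exact fun ζ hζ => memT y ζ hyn (hR ζ hζ) my
  · intro ζ hζ
    obtain ⟨x', hx', hdx⟩ := hasDerivAt_tsum_pow_smul hq hxn (hR ζ hζ)
    obtain ⟨y', hy', hdy⟩ := hasDerivAt_tsum_pow_smul hq hyn (hR ζ hζ)
    have sx := seriesT x ζ hxn (hR ζ hζ)
    have sy := seriesT y ζ hyn (hR ζ hζ)
    have ex := fourierCoefficient_derivative (f := fun n => T (x n)) (g := fun n => T (y n)) rx
      sx.1 sy.1 (by simpa only [map_smul] using hx'.mapL T)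
    have ey := fourierCoefficient_derivative (f := fun n => T (y n)) (g := fun n => T (x n)) ry
      sy.1 sx.1 (by simpa only [map_smul] using hy'.mapL T)
    simp only [sx.2.tsum_eq, sy.2.tsum_eq] at ex ey
    obtain ⟨p, hp1, hp2⟩ := exists_pressure hβ (memT x ζ hxn (hR ζ hζ) mx)
      (memT y ζ hyn (hR ζ hζ) my) (wiener_weightedField_ne_top hβ.le _)
      (wiener_weightedField_ne_top hβ.le _) ex ey
    exact ⟨T x', T y', p, T.hasFDerivAt.comp_hasDerivAt ζ hdx,
      T.hasFDerivAt.comp_hasDerivAt ζ hdy, hp1, hp2⟩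
  · have h := hinit x hxn
    rwa [x0] at h
  · have h := hinit y hyn
    rwa [y0] at h
  · intro r hr ζ hζ
    obtain ⟨x', -, hdx⟩ := hasDerivAt_tsum_pow_smul hq hxn (hR ζ hζ)
    obtain ⟨y', -, hdy⟩ := hasDerivAt_tsum_pow_smul hq hyn (hR ζ hζ)
    exact ⟨gevreyDifferentiableAt_weightedField hr hβ hdx,
      gevreyDifferentiableAt_weightedField hr hβ hdy⟩

end Existence

/-! ### Geometry of the region and the size of its constant -/

section Region

lemma region_eq (d : ℕ) (C r β₀ N : ℝ) :
    region d C r β₀ N =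
      {ζ : ℂ | ‖ζ‖ * ((2 : ℝ) ^ r * wienerConst d r * N) < C * β₀} \ {0} := by
  ext ζ
  simp [region, and_comm]

/-- The set is a disc, or the whole plane when `a = 0`, as happens for zero data. -/
lemma isPreconnected_norm_mul_lt {a b : ℝ} (ha : 0 ≤ a) (hb : 0 < b) :
    IsPreconnected {ζ : ℂ | ‖ζ‖ * a < b} := by
  rcases ha.eq_or_lt with rfl | ha
  · simpa [hb] using isPreconnected_univ
  · have : {ζ : ℂ | ‖ζ‖ * a < b} = Metric.ball 0 (b / a) := by
      ext ζ
      simp [lt_div_iff₀ ha]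
    rw [this]
    exact (convex_ball (0 : ℂ) _).isPreconnected

/-- Both `2^r` and `(2r - d) / (2r - 1 - d)` are at least one. This lower bound, free of `r`, is
what allows `C` to depend on `d` alone. -/
lemma le_two_rpow_mul_wienerConst {d : ℕ} {r : ℝ} (hr : ((d : ℝ) + 1) / 2 < r) :
    1 / (Real.pi * 2 ^ ((d : ℝ) - 1)) ≤ (2 : ℝ) ^ r * wienerConst d r := by
  have hd : (0 : ℝ) ≤ d := Nat.cast_nonneg d
  have h1 : (1 : ℝ) ≤ 2 ^ r := Real.one_le_rpow (by norm_num) (by linarith)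
  have h2 : 1 ≤ (2 * r - d) / (2 * r - 1 - d) := by
    rw [le_div_iff₀ (by linarith)]
    linarith
  have h3 : 0 < 1 / (Real.pi * (2 : ℝ) ^ ((d : ℝ) - 1)) := by positivity
  unfold wienerConst
  calc _ = 1 * (1 / (Real.pi * 2 ^ ((d : ℝ) - 1)) * 1) := by ring
    _ ≤ _ := by gcongr

end Region

end MHD

end

/-! ### Choice of the constant and proof of the theorem -/

theorem theorem6p1 (d : ℕ) (hd : d = 2 ∨ d = 3) :
    ∃ C : ℝ, 0 < C ∧
      ∀ r : ℝ, ((d : ℝ) + 1) / 2 < r →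
      ∀ β₀ : ℝ, 0 < β₀ →
      ∀ v₀ w₀ : MHD.L2 d, MHD.MemH v₀ → MHD.MemH w₀ →
        MHD.GevreyFinite r β₀ v₀ → MHD.GevreyFinite r β₀ w₀ →
        ∃ v w : ℂ → MHD.L2 d,
          MHD.IsSolution (MHD.region d C r β₀ (MHD.gevreyPairNorm r β₀ v₀ w₀)) v₀ w₀ v w ∧
          (∀ ζ ∈ MHD.region d C r β₀ (MHD.gevreyPairNorm r β₀ v₀ w₀),
            MHD.GevreyDifferentiableAt r v ζ ∧ MHD.GevreyDifferentiableAt r w ζ) ∧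
          ∀ v₁ w₁ : ℂ → MHD.L2 d,
            MHD.IsSolution (MHD.region d C r β₀ (MHD.gevreyPairNorm r β₀ v₀ w₀)) v₀ w₀ v₁ w₁ →
            ∀ ζ ∈ MHD.region d C r β₀ (MHD.gevreyPairNorm r β₀ v₀ w₀),
              v₁ ζ = v ζ ∧ w₁ ζ = w ζ := by
  set κ : ℝ := 1 / (Real.pi * 2 ^ ((d : ℝ) - 1)) with hκdef
  have hκ : 0 < κ := by positivity
  set s : ℝ := Real.sqrt (∑' k : Fin d → ℤ, MHD.freqNorm k ^ (-((d : ℝ) + 1))) with hs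
  have hs0 : 0 ≤ s := Real.sqrt_nonneg _
  have hB := MHD.bilinearConst_nonneg d
  -- The `64` is `32` from the radius of convergence times `2` from `N = 2 s G`, each field having
  -- Gevrey norm at most `G`. The `+ 1` makes `A` positive without a lower bound on `s`.
  set A : ℝ := 64 * MHD.bilinearConst d * s + 1 with hA
  have hA0 : 0 < A := by positivity
  refine ⟨κ / A, by positivity, ?_⟩
  intro r hr β₀ hβ₀ v₀ w₀ hv₀ hw₀ fv fw
  have hr0 : 0 < r := by
    have : (0 : ℝ) ≤ d := Nat.cast_nonneg d
    linarith
  set G := MHD.gevreyPairNorm r β₀ v₀ w₀ with hG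
  have hG0 : 0 ≤ G := Real.sqrt_nonneg _
  have hvG : MHD.gevreyNorm r β₀ v₀ ≤ G :=
    Real.le_sqrt_of_sq_le (le_add_of_nonneg_right (sq_nonneg _))
  have hwG : MHD.gevreyNorm r β₀ w₀ ≤ G :=
    Real.le_sqrt_of_sq_le (le_add_of_nonneg_left (sq_nonneg _))
  have hW : MHD.wiener β₀ (MHD.fourierCoefficient v₀) + MHD.wiener β₀ (MHD.fourierCoefficient w₀)
      ≤ ENNReal.ofReal (2 * s * G) := by
    have h1 := (MHD.wiener_le_gevreyNorm hr hv₀.1 fv).trans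
      (ENNReal.ofReal_le_ofReal (mul_le_mul_of_nonneg_left hvG hs0))
    have h2 := (MHD.wiener_le_gevreyNorm hr hw₀.1 fw).trans
      (ENNReal.ofReal_le_ofReal (mul_le_mul_of_nonneg_left hwG hs0))
    refine (add_le_add h1 h2).trans (le_of_eq ?_)
    rw [← ENNReal.ofReal_add (by positivity) (by positivity)]
    congr 1
    ring
  have hK := MHD.le_two_rpow_mul_wienerConst hr
  rw [← hκdef] at hK
  have hregion : ∀ ζ ∈ MHD.region d (κ / A) r β₀ G,
      ‖ζ‖ * (32 * MHD.bilinearConst d * (2 * s * G) / β₀) < 1 := by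
    intro ζ hζ
    have h1 : ‖ζ‖ * (κ * G) < κ / A * β₀ := by
      refine lt_of_le_of_lt ?_ hζ.2
      gcongr
    have h2 : ‖ζ‖ * G * A < β₀ := by
      have h3 : ‖ζ‖ * (κ * G) = κ / A * (‖ζ‖ * G * A) := by field_simp
      rw [h3] at h1
      exact lt_of_mul_lt_mul_left h1 (by positivity)
    rw [← mul_div_assoc, div_lt_one hβ₀]
    refine lt_of_le_of_lt ?_ h2
    have h4 : 0 ≤ ‖ζ‖ * G := by positivity
    rw [hA]
    nlinarith
  obtain ⟨v, w, hsol, hgev⟩ := MHD.exists_isSolution hβ₀ (by positivity) hv₀ hw₀ hW hregion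
  refine ⟨v, w, hsol, hgev r hr0, fun v₁ w₁ h₁ ζ hζ => ?_⟩
  rw [MHD.region_eq] at hsol h₁ hζ
  have hC : 0 < κ / A * β₀ := by positivity
  refine MHD.IsSolution.eqOn (isOpen_lt (by fun_prop) continuous_const)
    (MHD.isPreconnected_norm_mul_lt (mul_nonneg (hκ.le.trans hK) hG0) hC) (by simpa using hC)
    hsol h₁ hζ
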